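/- For $t>1$ write $t'=\frac{t}{t-1}$ and $C_t=\sqrt{t^{1/t}/t'^{\,1/t'}}$. For a random vector $X$ in $\mathbb R^n$ with density $f$ with respect to Lebesgue measure, write $S(X)=\int f\log f$. **Theorem (Sharp Young's convolution inequality).** Let $p,q,r>1$ satisfy $\frac1p+\frac1q=1+\frac1r$. (1) For all real random variables $X,Y$ defined on a common probability space such that $X$, $X-Y$, $Y$ and $(X,Y)$ have densities and well-defined finite entropies, $$\frac1{r'}S(X)+\frac1p S(X-Y)+\frac1q S(Y)\le S(X,Y)+\log\Big(\frac{C_pC_q}{C_r}\Big).$$ The additive constant $\log(C_pC_q/C_r)$ is the smallest possible. (2) For such $X,Y$, equality holds in (1) if and only if $(X,Y)$ is a Gaussian vector and the covariance matrix of $(Y,X)$ is a positive multiple of $AA^*$, where $$A=\begin{pmatrix}\cot\theta_3&1\\ \cot\theta_3-\cot\theta_2&0\end{pmatrix}$$ and $\theta_2,\theta_3\in(0,\pi)$ are given by $$(\cos\theta_2,\sin\theta_2)=\Big(\sqrt{(r'-1)(p-1)},\sqrt{\tfrac{r'p}{q'}}\Big),\qquad (\cos\theta_3,\sin\theta_3)=\Big(-\sqrt{(r'-1)(q-1)},\sqrt{\tfrac{r'q}{p'}}\Big).$$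 (3) For all $f\in L^p(\mathbb R)$ and $g\in L^q(\mathbb R)$ (real-valued), the convolution $f*g$ is defined almost everywhere, belongs to $L^r(\mathbb R)$, and $$\|f*g\|_{L^r(\mathbb R)}\le\frac{C_pC_q}{C_r}\,\|f\|_{L^p(\mathbb R)}\,\|g\|_{L^q(\mathbb R)}.$$ The constant $C_pC_q/C_r$ is the smallest possible. (4) The two inequalities are equivalent: for every real $D$, the inequality in (1) holds with additive constant $D$ for all such $X,Y$ if and only if the inequality in (3) holds with multiplicative constant $e^D$ for all such $f,g$. -/

import Mathlib

open MeasureTheory ProbabilityTheory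
open scoped ENNReal Convolution

universe u

noncomputable section

/-- The entropy `S(X) = ∫ f log f` with respect to Lebesgue measure, where `f` is the density
of `X`. (With this sign convention `S` is minus the usual differential entropy.) -/
def entropyS {Ω E : Type*} [MeasurableSpace Ω] [MeasureSpace E] (X : Ω → E) (P : Measure Ω) : ℝ :=
  ∫ x, (pdf X P volume x).toReal * Real.log (pdf X P volume x).toReal

/-- `X` has a density `f` with respect to Lebesgue measure, and its entropy `∫ f log f` is well
defined and finite. -/
structure HasFiniteEntropy {Ω E : Type*} [MeasurableSpace Ω] [MeasureSpace E]
    (X : Ω → E) (P : Measure Ω) : Prop where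
  hasPDF : HasPDF X P volume
  integrable : Integrable
    (fun x => (pdf X P volume x).toReal * Real.log (pdf X P volume x).toReal) (volume : Measure E)

/-- All the entropies `S(X)`, `S(X - Y)`, `S(Y)`, `S(X, Y)` are well defined and finite. -/
structure FiniteEntropies {Ω : Type*} [MeasurableSpace Ω] (P : Measure Ω) (X Y : Ω → ℝ) :
    Prop where
  left : HasFiniteEntropy X P
  sub : HasFiniteEntropy (fun ω => X ω - Y ω) P
  right : HasFiniteEntropy Y P
  joint : HasFiniteEntropy (fun ω => (X ω, Y ω)) P

/-- The left-hand side `(1/r') S(X) + (1/p) S(X - Y) + (1/q) S(Y)`. -/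
def entropySum {Ω : Type*} [MeasurableSpace Ω] (p q r : ℝ) (P : Measure Ω) (X Y : Ω → ℝ) : ℝ :=
  1 / r.conjExponent * entropyS X P + 1 / p * entropyS (fun ω => X ω - Y ω) P
    + 1 / q * entropyS Y P

/-- The entropic form of Young's inequality holds with additive constant `D`. -/
def EntropicYoung (p q r D : ℝ) : Prop :=
  ∀ (Ω : Type u) [MeasurableSpace Ω] (P : Measure Ω) [IsProbabilityMeasure P] (X Y : Ω → ℝ),
    FiniteEntropies P X Y →
      entropySum p q r P X Y ≤ entropyS (fun ω => (X ω, Y ω)) P + D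

/-- Young's convolution inequality `‖f * g‖_r ≤ K ‖f‖_p ‖g‖_q` for all `f ∈ L^p(ℝ)` and
`g ∈ L^q(ℝ)`; the convolution integral exists at almost every point and defines an element
of `L^r(ℝ)`. -/
def ConvolutionYoung (p q r K : ℝ) : Prop :=
  ∀ f g : ℝ → ℝ, MemLp f (ENNReal.ofReal p) volume → MemLp g (ENNReal.ofReal q) volume →
    (∀ᵐ x, ConvolutionExistsAt f g x (ContinuousLinearMap.mul ℝ ℝ) volume) ∧
    MemLp (f ⋆[ContinuousLinearMap.mul ℝ ℝ, volume] g) (ENNReal.ofReal r) volume ∧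
    eLpNorm (f ⋆[ContinuousLinearMap.mul ℝ ℝ, volume] g) (ENNReal.ofReal r) volume ≤
      ENNReal.ofReal K *
        eLpNorm f (ENNReal.ofReal p) volume * eLpNorm g (ENNReal.ofReal q) volume

/-- `C_t = sqrt (t^(1/t) / t'^(1/t'))`, where `t' = t / (t - 1)`. -/
def youngC (t : ℝ) : ℝ :=
  √(t ^ (1 / t) / t.conjExponent ^ (1 / t.conjExponent))

/-- `cot θ₂`, where `(cos θ₂, sin θ₂) = (√((r'-1)(p-1)), √(r' p / q'))`. -/
def cotTheta₂ (p q r : ℝ) : ℝ :=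
  √((r.conjExponent - 1) * (p - 1)) / √(r.conjExponent * p / q.conjExponent)

/-- `cot θ₃`, where `(cos θ₃, sin θ₃) = (-√((r'-1)(q-1)), √(r' q / p'))`. -/
def cotTheta₃ (p q r : ℝ) : ℝ :=
  -√((r.conjExponent - 1) * (q - 1)) / √(r.conjExponent * q / p.conjExponent)

/-- The matrix `A` with rows `(cot θ₃, 1)` and `(cot θ₃ - cot θ₂, 0)`. -/
def youngA (p q r : ℝ) : Matrix (Fin 2) (Fin 2) ℝ :=
  !![cotTheta₃ p q r, 1; cotTheta₃ p q r - cotTheta₂ p q r, 0]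

/-- The covariance matrix of the random vector `(U, V)`. -/
def covMatrix {Ω : Type*} [MeasurableSpace Ω] (P : Measure Ω) (U V : Ω → ℝ) :
    Matrix (Fin 2) (Fin 2) ℝ :=
  !![covariance U U P, covariance U V P; covariance V U P, covariance V V P]

end

/-! ### Monotone transport on the line -/

/-! With the weights a = 1 - 1/p, b = 1 - 1/q, c = 1/r, which are positive and sum to 1, both
inequalities are equivalent to a trilinear one: for probability densities f₁, f₂, f₃, the integral
over the plane of f₁(x-y)^(1-a) f₂(y)^(1-b) f₃(x)^(1-c) is at most K.

The sharp trilinear bound comes from mass transport. Let Tᵢ be the monotone maps carrying fᵢ to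
centered Gaussians of variances a(1-a), b(1-b), c(1-c), and let s = T₁(x-y) + T₂(y) - T₃(x). The
point (T₁ - as, T₂ - bs, T₃ + cs) is the orthogonal projection of (T₁, T₂, T₃) onto the plane t₁ +
t₂ = t₃ for the quadratic form t₁²/a + t₂²/b + t₃²/c, so it has the form (u-v, v, u). The map (x,y)
↦ (u,v) is injective, weighted AM-GM bounds its Jacobian below by the product of the powers of the
Tᵢ', and Pythagoras gains a factor exp(-s²/2) in the Gaussian integrand (`young_pointwise`).
Changing variables gives `lintegral_youngForm_le`. Equality forces s = 0 almost everywhere; the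
inverse maps then solve a Pexider equation, so they are affine with a common slope
(`exists_affine_of_ae_sub_eq`), and the extremal integrand is an affine image of the Gaussian one.

The entropic inequality is Gibbs' inequality for the joint density against the product of powers of
the marginal densities, whose total mass is at most K. Equality there makes that product equal to K
times the joint density, hence an extremal of the trilinear problem (`entropy_eq_iff`). Conversely,
testing the entropic inequality on the normalized trilinear integrand recovers the trilinear bound
(`PlaneEntropicYoung.trilinearYoung`). The trilinear and convolution inequalities are dual to each
other through Hölder in x. Every passage keeps the constant, so optimality for all forms follows
from one Gaussian vector attaining equality in the entropic form. -/

lemma Monotone.lt_of_hasDerivAt_pos {F : ℝ → ℝ} (hF : Monotone F) {t d : ℝ}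
    (h : HasDerivAt F d t) (hd : 0 < d) :
    (∀ s, s < t → F s < F t) ∧ ∀ s, t < s → F t < F s := by
  have h1 : ∀ᶠ s in nhdsWithin t {t}ᶜ, 0 < slope F t s :=
    (hasDerivAt_iff_tendsto_slope.1 h).eventually (lt_mem_nhds hd)
  constructor
  · intro s hs
    have h2 : ∀ᶠ u in nhdsWithin t (Set.Iio t), 0 < slope F t u :=
      h1.filter_mono (nhdsWithin_mono _ fun u hu => ne_of_lt hu)
    obtain ⟨u, hu, hu2⟩ := (h2.and (Ioo_mem_nhdsLT hs)).exists
    refine (hF hu2.1.le).trans_lt ?_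
    rw [slope_comm, slope_pos_iff_of_le hu2.2.le] at hu
    exact hu
  · intro s hs
    have h2 : ∀ᶠ u in nhdsWithin t (Set.Ioi t), 0 < slope F t u :=
      h1.filter_mono (nhdsWithin_mono _ fun u hu => ne_of_gt hu)
    obtain ⟨u, hu, hu2⟩ := (h2.and (Ioo_mem_nhdsGT hs)).exists
    refine lt_of_lt_of_le ?_ (hF hu2.2.le)
    rw [slope_pos_iff_of_le hu2.1.le] at hu
    exact hu

lemma isProbabilityMeasure_withDensity_of_lintegral {E : Type*} [MeasurableSpace E]
    {μ : Measure E} {f : E → ℝ≥0∞} (h : ∫⁻ x, f x ∂μ = 1) :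
    IsProbabilityMeasure (μ.withDensity f) := ⟨by simpa using h⟩

lemma cdf_withDensity_ofReal {φ : ℝ → ℝ} (hi : Integrable φ) (h0 : ∀ u, 0 ≤ φ u)
    (h1 : ∫ u, φ u = 1) (u : ℝ) :
    cdf (volume.withDensity fun u => ENNReal.ofReal (φ u)) u = ∫ x in Set.Iic u, φ x := by
  have : IsProbabilityMeasure (volume.withDensity fun u => ENNReal.ofReal (φ u)) := by
    apply isProbabilityMeasure_withDensity_of_lintegral
    rw [← ofReal_integral_eq_lintegral_ofReal hi (Filter.Eventually.of_forall h0), h1]; simp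
  rw [cdf_eq_real, measureReal_def, withDensity_apply _ measurableSet_Iic,
    ← ofReal_integral_eq_lintegral_ofReal hi.integrableOn (Filter.Eventually.of_forall h0),
    ENNReal.toReal_ofReal (integral_nonneg h0)]

lemma hasDerivAt_setIntegral_Iic {φ : ℝ → ℝ} (hi : Integrable φ) (hc : Continuous φ) (u : ℝ) :
    HasDerivAt (fun u => ∫ x in Set.Iic u, φ x) (φ u) u := by
  have h : (fun u => ∫ x in Set.Iic u, φ x)
      = fun u => (∫ x in Set.Iic 0, φ x) + ∫ x in (0 : ℝ)..u, φ x := by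
    ext u
    rw [← intervalIntegral.integral_Iic_sub_Iic hi.integrableOn hi.integrableOn]; ring
  rw [h]
  exact (intervalIntegral.integral_hasDerivAt_right hi.intervalIntegrable
    (hc.stronglyMeasurableAtFilter _ _) hc.continuousAt).const_add _

/-- The monotone map `T` transporting a probability density `f` on the line to a continuous
positive probability density `φ`, together with the monotone quantile map `R` inverting it. -/
theorem exists_monotone_transport {f : ℝ → ℝ≥0∞} (hf : Measurable f) (hf1 : ∫⁻ t, f t = 1)
    {φ : ℝ → ℝ} (hc : Continuous φ) (hi : Integrable φ) (h0 : ∀ u, 0 < φ u)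
    (h1 : ∫ u, φ u = 1) :
    ∃ (T T' R : ℝ → ℝ) (A : Set ℝ), MeasurableSet A ∧ Monotone R ∧ (∀ᵐ t, f t ≠ 0 → t ∈ A) ∧
      ∀ t ∈ A, HasDerivAt T (T' t) t ∧ 0 < T' t ∧ f t = ENNReal.ofReal (T' t * φ (T t)) ∧
        R (T t) = t := by
  have hμ := isProbabilityMeasure_withDensity_of_lintegral hf1
  set μ := volume.withDensity f
  set F : ℝ → ℝ := fun t => cdf μ t with hFdef
  have hFm : Monotone F := monotone_cdf μ
  have hFd : ∀ᵐ t, HasDerivAt F (f t).toReal t := by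
    -- Lebesgue differentiation: f is only measurable, so F has derivative f almost everywhere and
    -- not everywhere.
    have := (cdf μ).ae_hasDerivAt
    rw [measure_cdf] at this
    filter_upwards [this, Measure.rnDeriv_withDensity volume hf] with t ht ht2
    rwa [ht2] at ht
  have hftop : ∀ᵐ t, f t ≠ ∞ := by
    filter_upwards [ae_lt_top hf (by rw [hf1]; simp)] with t ht using ht.ne
  set G : ℝ → ℝ := fun u => ∫ x in Set.Iic u, φ x with hGdef
  have hGd : ∀ u, HasDerivAt G (φ u) u := hasDerivAt_setIntegral_Iic hi hc
  have hGc : Continuous G := continuous_iff_continuousAt.2 fun u => (hGd u).continuousAt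
  have hGm : StrictMono G := strictMono_of_deriv_pos fun u => by rw [(hGd u).deriv]; exact h0 u
  have hGcdf := cdf_withDensity_ofReal hi (fun u => (h0 u).le) h1
  set ν := volume.withDensity fun u => ENNReal.ofReal (φ u)
  have hG0 : Filter.Tendsto G Filter.atBot (nhds 0) :=
    (tendsto_cdf_atBot ν).congr hGcdf
  have hG1 : Filter.Tendsto G Filter.atTop (nhds 1) :=
    (tendsto_cdf_atTop ν).congr hGcdf
  have hGpos : ∀ u, 0 < G u := fun u =>
    (hGm.monotone.le_of_tendsto hG0 (u - 1)).trans_lt (hGm (by linarith))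
  have hGlt : ∀ u, G u < 1 := fun u =>
    (hGm (show u < u + 1 by linarith)).trans_le (hGm.monotone.ge_of_tendsto hG1 (u + 1))
  have hsurj : ∀ s ∈ Set.Ioo (0 : ℝ) 1, ∃ u, G u = s := by
    intro s hs
    obtain ⟨u, hu⟩ := (hG0.eventually (gt_mem_nhds hs.1)).exists
    obtain ⟨v, hv⟩ := (hG1.eventually (lt_mem_nhds hs.2)).exists
    exact mem_range_of_exists_le_of_exists_ge hGc ⟨u, hu.le⟩ ⟨v, hv.le⟩
  set H : ℝ → ℝ := Function.invFun G with hHdef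
  have hHG : ∀ u, H (G u) = u := Function.leftInverse_invFun hGm.injective
  have hGH : ∀ s ∈ Set.Ioo (0 : ℝ) 1, G (H s) = s := by
    intro s hs; obtain ⟨u, rfl⟩ := hsurj s hs; rw [hHG]
  have hHm : StrictMonoOn H (Set.Ioo 0 1) := by
    intro s hs t ht hst
    rw [← hGm.lt_iff_lt, hGH s hs, hGH t ht]; exact hst
  have hHd : ∀ s ∈ Set.Ioo (0 : ℝ) 1, HasDerivAt H (φ (H s))⁻¹ s := by
    intro s hs
    have hnhds : Set.Ioo (0 : ℝ) 1 ∈ nhds s := Ioo_mem_nhds hs.1 hs.2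
    refine HasDerivAt.of_local_left_inverse ?_ (hGd _) (h0 _).ne' ?_
    · refine hHm.continuousAt_of_image_mem_nhds hnhds ?_
      convert Filter.univ_mem
      ext u
      simp only [Set.mem_image, Set.mem_univ, iff_true]
      exact ⟨G u, ⟨hGpos u, hGlt u⟩, hHG u⟩
    · filter_upwards [hnhds] with y hy using hGH y hy
  -- A measurable null hull of the exceptional set, so that the good set A is measurable.
  set N := toMeasurable volume {t | ¬ HasDerivAt F (f t).toReal t}
  have hN : volume N = 0 := by rw [measure_toMeasurable]; exact hFd
  -- T is G⁻¹ ∘ F and T' comes from the chain rule. R is the lower quantile of F at level G u, which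
  -- is monotone on all of ℝ even where F has flat pieces or T is not invertible.
  refine ⟨fun t => H (F t), fun t => (φ (H (F t)))⁻¹ * (f t).toReal,
    fun u => sInf {t | G u ≤ F t}, {t | f t ≠ 0 ∧ f t ≠ ∞} \ N, ?_, ?_, ?_, ?_⟩
  · refine MeasurableSet.diff ?_ (measurableSet_toMeasurable _ _)
    exact (hf (measurableSet_singleton 0).compl).inter (hf (measurableSet_singleton ∞).compl)
  · intro u v huv
    have ht0 := tendsto_cdf_atBot μ
    have ht1 := tendsto_cdf_atTop μ
    refine csInf_le_csInf ?_ ?_ ?_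
    · obtain ⟨t, ht⟩ := (ht0.eventually (gt_mem_nhds (hGpos u))).exists
      refine ⟨t, fun s hs => ?_⟩
      by_contra hlt
      exact absurd (hFm (not_le.1 hlt).le) (not_le.2 (lt_of_lt_of_le ht hs))
    · obtain ⟨t, ht⟩ := (ht1.eventually (lt_mem_nhds (hGlt v))).exists
      exact ⟨t, ht.le⟩
    · intro t ht
      exact (hGm.monotone huv).trans ht
  · filter_upwards [hftop, measure_eq_zero_iff_ae_notMem.1 hN] with t h h' h''
    exact ⟨⟨h'', h⟩, h'⟩
  · rintro t ⟨⟨ht0, ht⟩, htN⟩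
    have hd : HasDerivAt F (f t).toReal t := by
      by_contra hcon
      exact htN (subset_toMeasurable _ _ hcon)
    have hpos : 0 < (f t).toReal := ENNReal.toReal_pos ht0 ht
    obtain ⟨hl, hr⟩ := hFm.lt_of_hasDerivAt_pos hd hpos
    -- Strict growth of F at t keeps F t away from 0 and 1, so G⁻¹ is a true differentiable inverse
    -- there.
    have hI : F t ∈ Set.Ioo (0 : ℝ) 1 :=
      ⟨(cdf_nonneg μ (t - 1)).trans_lt (hl _ (by linarith)),
        (hr (t + 1) (by linarith)).trans_le (cdf_le_one μ _)⟩
    refine ⟨(hHd _ hI).comp t hd, mul_pos (inv_pos.2 (h0 _)) hpos, ?_, ?_⟩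
    · rw [mul_right_comm, inv_mul_cancel₀ (h0 _).ne', one_mul, ENNReal.ofReal_toReal ht]
    -- Since F is strictly below F t to the left of t, the quantile at this level is t itself.
    · have : {s | G (H (F t)) ≤ F s} = Set.Ici t := by
        ext s
        rw [hGH _ hI]
        refine ⟨fun hs => ?_, fun hs => hFm hs⟩
        by_contra hlt
        exact absurd (hl s (not_le.1 hlt)) (not_lt.2 hs)
      simp only [this, csInf_Ici]

/-! ### A functional equation for monotone functions -/

/-- A gap between f and g at x persists, by continuity of g, on one side of x; a point of agreement
there contradicts monotonicity of f. -/
lemma Monotone.eq_of_ae_eq_of_continuous {f g : ℝ → ℝ} (hf : Monotone f) (hg : Continuous g)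
    (h : f =ᵐ[volume] g) : f = g := by
  have hd : Dense {x | f x = g x} := Measure.dense_of_ae h
  ext x
  rcases lt_trichotomy (f x) (g x) with hlt | heq | hgt
  · exfalso
    obtain ⟨a, b, hab, hsub⟩ := mem_nhds_iff_exists_Ioo_subset.1
      (hg.continuousAt.eventually (lt_mem_nhds hlt))
    obtain ⟨y, hy, hy1, hy2⟩ := hd.exists_between hab.1
    have h1 : f x < g y := hsub ⟨hy1, hy2.trans hab.2⟩
    have h2 : f y = g y := hy
    linarith [hf hy2.le]
  · exact heq
  · exfalso
    obtain ⟨a, b, hab, hsub⟩ := mem_nhds_iff_exists_Ioo_subset.1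
      (hg.continuousAt.eventually (gt_mem_nhds hgt))
    obtain ⟨y, hy, hy1, hy2⟩ := hd.exists_between hab.2
    have h1 : g y < f x := hsub ⟨hab.1.trans hy1, hy2⟩
    have h2 : f y = g y := hy
    linarith [hf hy1.le]

/-- Averaging the equation over v in [0, 1] writes R₃ almost everywhere as a constant plus a sliding
integral of R₁, which is continuous in u. -/
lemma Monotone.continuous_of_ae_sub_eq {R₁ R₂ R₃ : ℝ → ℝ} (h₁ : Monotone R₁) (h₂ : Monotone R₂)
    (h₃ : Monotone R₃) (h : ∀ᵐ w : ℝ × ℝ, R₁ (w.1 - w.2) = R₃ w.1 - R₂ w.2) :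
    Continuous R₃ := by
  have hI : ∀ a b, IntervalIntegrable R₁ volume a b := fun a b => h₁.intervalIntegrable
  have hc : Continuous fun u => ∫ t in (u - 1)..u, R₁ t := by
    have h0 : Continuous fun u => ∫ t in (0 : ℝ)..u, R₁ t :=
      intervalIntegral.continuous_primitive hI 0
    have : (fun u => ∫ t in (u - 1)..u, R₁ t)
        = fun u => (∫ t in (0 : ℝ)..u, R₁ t) - ∫ t in (0 : ℝ)..(u - 1), R₁ t := by
      ext u; rw [intervalIntegral.integral_interval_sub_left (hI _ _) (hI _ _)]
    rw [this]
    exact h0.sub (h0.comp (by fun_prop))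
  have key : R₃ =ᵐ[volume] fun u => (∫ t in (u - 1)..u, R₁ t) + ∫ v in (0 : ℝ)..1, R₂ v := by
    filter_upwards [Measure.ae_ae_of_ae_prod h] with u hu
    have e1 : ∫ v in (0 : ℝ)..1, R₁ (u - v) = ∫ v in (0 : ℝ)..1, (R₃ u - R₂ v) :=
      intervalIntegral.integral_congr_ae (by filter_upwards [hu] with v hv _ using hv)
    rw [intervalIntegral.integral_comp_sub_left, intervalIntegral.integral_sub (by simp)
      h₂.intervalIntegrable] at e1
    simp at e1
    linarith
  rw [h₃.eq_of_ae_eq_of_continuous (by fun_prop) key]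
  fun_prop

/-- Monotone solutions of the Pexider equation `R₁ (u - v) = R₃ u - R₂ v`, assumed almost
everywhere, are affine with a common slope. -/
theorem exists_affine_of_ae_sub_eq {R₁ R₂ R₃ : ℝ → ℝ} (h₁ : Monotone R₁) (h₂ : Monotone R₂)
    (h₃ : Monotone R₃) (h : ∀ᵐ w : ℝ × ℝ, R₁ (w.1 - w.2) = R₃ w.1 - R₂ w.2) :
    ∃ l b₂ b₃ : ℝ, (∀ u, R₃ u = l * u + b₃) ∧ ∀ v, R₂ v = l * v + b₂ := by
  have c₃ : Continuous R₃ := h₁.continuous_of_ae_sub_eq h₂ h₃ h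
  have c₂ : Continuous R₂ := by
    -- Exchanging u and v preserves the equation if R₁ is replaced by its odd reflection, so R₂
    -- takes the place of R₃.
    refine Monotone.continuous_of_ae_sub_eq (R₁ := fun s => -R₁ (-s)) (R₂ := R₃)
      (fun x y hxy => neg_le_neg (h₁ (neg_le_neg hxy))) h₃ h₂ ?_
    have := (Measure.measurePreserving_swap (μ := (volume : Measure ℝ))
      (ν := (volume : Measure ℝ))).quasiMeasurePreserving.ae h
    filter_upwards [this] with w hw
    simp only [Prod.fst_swap, Prod.snd_swap] at hw
    rw [neg_sub, hw]; ring
  have c₁ : Continuous R₁ := by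
    have := (Measure.measurePreserving_swap (μ := (volume : Measure ℝ))
      (ν := (volume : Measure ℝ))).quasiMeasurePreserving.ae h
    obtain ⟨v, hv⟩ := (Measure.ae_ae_of_ae_prod this).exists
    have h4 : R₁ =ᵐ[volume] fun w => R₃ (w + v) - R₂ v := by
      filter_upwards [(measurePreserving_add_right volume v).quasiMeasurePreserving.ae hv]
        with w hw
      simpa using hw
    rw [h₁.eq_of_ae_eq_of_continuous (by fun_prop) h4]
    fun_prop
  have hall : (fun w : ℝ × ℝ => R₁ (w.1 - w.2)) = fun w => R₃ w.1 - R₂ w.2 :=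
    (Continuous.ae_eq_iff_eq volume (by fun_prop) (by fun_prop)).1 h
  have e : ∀ u v, R₁ (u - v) = R₃ u - R₂ v := fun u v => congrFun hall (u, v)
  -- Now that the equation holds everywhere, it says that R₃ - R₃ 0 is additive; continuity makes it
  -- linear.
  let φ : ℝ →+ ℝ := AddMonoidHom.ofMapSub (fun u => R₃ u - R₃ 0) (fun u v => by
    have e1 := e u v
    have e2 := e (u - v) 0
    have e3 := e v v
    have e4 := e 0 0
    simp only [sub_zero, sub_self] at e2 e3 e4
    linarith)
  have hφ : ∀ u, R₃ u - R₃ 0 = (R₃ 1 - R₃ 0) * u := by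
    intro u
    have := map_real_smul φ (show Continuous fun u => R₃ u - R₃ 0 by fun_prop) u 1
    change R₃ (u • 1) - R₃ 0 = u • (R₃ 1 - R₃ 0) at this
    simp only [smul_eq_mul, mul_one] at this
    linarith
  refine ⟨R₃ 1 - R₃ 0, R₂ 0, R₃ 0, fun u => by linarith [hφ u], fun v => ?_⟩
  have e3 := e v v
  have e4 := e 0 0
  simp only [sub_self] at e3 e4
  linarith [hφ v]

/-! ### The trilinear form of Young's inequality -/

/-- The integrand `f₁(x - y)^(1-a) f₂(y)^(1-b) f₃(x)^(1-c)` of the trilinear form of Young's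
inequality. -/
noncomputable def youngForm (a b c : ℝ) (f₁ f₂ f₃ : ℝ → ℝ≥0∞) (z : ℝ × ℝ) : ℝ≥0∞ :=
  f₁ (z.1 - z.2) ^ (1 - a) * f₂ z.2 ^ (1 - b) * f₃ z.1 ^ (1 - c)

@[fun_prop]
lemma measurable_youngForm {a b c : ℝ} {f₁ f₂ f₃ : ℝ → ℝ≥0∞} (h₁ : Measurable f₁)
    (h₂ : Measurable f₂) (h₃ : Measurable f₃) : Measurable (youngForm a b c f₁ f₂ f₃) := by
  unfold youngForm; fun_prop

/-- The centered Gaussian density with variance `a (1 - a)`. -/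
noncomputable def youngDensity (a : ℝ) : ℝ → ℝ := gaussianPDFReal 0 (a * (1 - a)).toNNReal

/-- The extremal integrand, built from Gaussian densities. -/
noncomputable def youngGauss (a b c : ℝ) : ℝ × ℝ → ℝ≥0∞ :=
  youngForm a b c (fun t => ENNReal.ofReal (youngDensity a t))
    (fun t => ENNReal.ofReal (youngDensity b t)) (fun t => ENNReal.ofReal (youngDensity c t))

lemma youngDensity_pos {a : ℝ} (ha : 0 < a) (ha1 : a < 1) (t : ℝ) : 0 < youngDensity a t :=
  gaussianPDFReal_pos _ _ _ (by
    rw [ne_eq, Real.toNNReal_eq_zero, not_le]; exact mul_pos ha (by linarith))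

/-- This explains the variance a(1-a): the power 1-a cancels one factor and leaves the exponent
t²/(2a), so the three Gaussians combine into a form with weights 1/a, 1/b, 1/c. -/
lemma youngDensity_rpow {a : ℝ} (ha : 0 < a) (ha1 : a < 1) (t : ℝ) :
    youngDensity a t ^ (1 - a)
      = (√(2 * Real.pi * (a * (1 - a))))⁻¹ ^ (1 - a) * Real.exp (-(t ^ 2 / a) / 2) := by
  have h1 : 0 < 1 - a := by linarith
  have h : 0 < a * (1 - a) := mul_pos ha h1
  rw [youngDensity, gaussianPDFReal, Real.coe_toNNReal _ h.le,
    Real.mul_rpow (by positivity) (Real.exp_pos _).le, ← Real.exp_mul]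
  congr 2
  rw [sub_zero]
  field_simp

lemma continuous_youngDensity (a : ℝ) : Continuous (youngDensity a) := by
  unfold youngDensity; rw [gaussianPDFReal_def]; fun_prop

/-- The normalizing constant of `youngGauss`. -/
noncomputable def youngGaussConst (a b c : ℝ) : ℝ :=
  (√(2 * Real.pi * (a * (1 - a))))⁻¹ ^ (1 - a) * (√(2 * Real.pi * (b * (1 - b))))⁻¹ ^ (1 - b)
    * (√(2 * Real.pi * (c * (1 - c))))⁻¹ ^ (1 - c)

/-- Positive weights summing to one. -/
structure YoungWeights (a b c : ℝ) : Prop where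
  a_pos : 0 < a
  b_pos : 0 < b
  c_pos : 0 < c
  sum_eq : a + b + c = 1

namespace YoungWeights

variable {a b c : ℝ}

lemma a_lt (h : YoungWeights a b c) : a < 1 := by linarith [h.b_pos, h.c_pos, h.sum_eq]
lemma b_lt (h : YoungWeights a b c) : b < 1 := by linarith [h.a_pos, h.c_pos, h.sum_eq]
lemma c_lt (h : YoungWeights a b c) : c < 1 := by linarith [h.a_pos, h.b_pos, h.sum_eq]

lemma const_pos (h : YoungWeights a b c) : 0 < youngGaussConst a b c := by
  have := h.a_pos; have := h.b_pos; have := h.c_pos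
  have : 0 < 1 - a := by linarith [h.a_lt]
  have : 0 < 1 - b := by linarith [h.b_lt]
  have : 0 < 1 - c := by linarith [h.c_lt]
  unfold youngGaussConst
  have := Real.pi_pos
  positivity

end YoungWeights

/-- The product of the Gaussian factors at arbitrary arguments. -/
lemma youngDensity_prod {a b c : ℝ} (h : YoungWeights a b c) (t₁ t₂ t₃ : ℝ) :
    youngDensity a t₁ ^ (1 - a) * youngDensity b t₂ ^ (1 - b) * youngDensity c t₃ ^ (1 - c)
      = youngGaussConst a b c * Real.exp (-(t₁ ^ 2 / a + t₂ ^ 2 / b + t₃ ^ 2 / c) / 2) := by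
  rw [youngDensity_rpow h.a_pos h.a_lt, youngDensity_rpow h.b_pos h.b_lt,
    youngDensity_rpow h.c_pos h.c_lt, youngGaussConst]
  have : Real.exp (-(t₁ ^ 2 / a + t₂ ^ 2 / b + t₃ ^ 2 / c) / 2)
      = Real.exp (-(t₁ ^ 2 / a) / 2) * Real.exp (-(t₂ ^ 2 / b) / 2)
        * Real.exp (-(t₃ ^ 2 / c) / 2) := by
    rw [← Real.exp_add, ← Real.exp_add]; congr 1; ring
  rw [this]; ring

lemma ofReal_prod_rpow {a b c x y z : ℝ} (h : YoungWeights a b c) (hx : 0 ≤ x) (hy : 0 ≤ y)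
    (hz : 0 ≤ z) :
    ENNReal.ofReal x ^ (1 - a) * ENNReal.ofReal y ^ (1 - b) * ENNReal.ofReal z ^ (1 - c)
      = ENNReal.ofReal (x ^ (1 - a) * y ^ (1 - b) * z ^ (1 - c)) := by
  rw [ENNReal.ofReal_rpow_of_nonneg hx (by linarith [h.a_lt]),
    ENNReal.ofReal_rpow_of_nonneg hy (by linarith [h.b_lt]),
    ENNReal.ofReal_rpow_of_nonneg hz (by linarith [h.c_lt]),
    ENNReal.ofReal_mul (by positivity), ENNReal.ofReal_mul (by positivity)]

lemma youngGauss_eq {a b c : ℝ} (h : YoungWeights a b c) (w : ℝ × ℝ) :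
    youngGauss a b c w = ENNReal.ofReal (youngGaussConst a b c *
      Real.exp (-((w.1 - w.2) ^ 2 / a + w.2 ^ 2 / b + w.1 ^ 2 / c) / 2)) := by
  rw [youngGauss, youngForm, ofReal_prod_rpow h (youngDensity_pos h.a_pos h.a_lt _).le
    (youngDensity_pos h.b_pos h.b_lt _).le (youngDensity_pos h.c_pos h.c_lt _).le,
    youngDensity_prod h]

lemma youngGauss_ne_zero {a b c : ℝ} (h : YoungWeights a b c) (w : ℝ × ℝ) :
    youngGauss a b c w ≠ 0 := by
  rw [youngGauss_eq h, ne_eq, ENNReal.ofReal_eq_zero, not_le]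
  exact mul_pos h.const_pos (Real.exp_pos _)

lemma youngGauss_ne_top {a b c : ℝ} (h : YoungWeights a b c) (w : ℝ × ℝ) :
    youngGauss a b c w ≠ ∞ := by
  rw [youngGauss_eq h]; exact ENNReal.ofReal_ne_top

lemma measurable_youngGauss (a b c : ℝ) : Measurable (youngGauss a b c) := by
  have := fun a => (continuous_youngDensity a).measurable
  unfold youngGauss; fun_prop

/-! ### Transport in the plane -/

/-- The differential of the transport map in the plane. -/
noncomputable def planeTransportDeriv (b c l₁ l₂ l₃ : ℝ) : ℝ × ℝ →L[ℝ] ℝ × ℝ :=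
  let p := ContinuousLinearMap.fst ℝ ℝ ℝ
  let q := ContinuousLinearMap.snd ℝ ℝ ℝ
  let s := l₁ • (p - q) + l₂ • q - l₃ • p
  (l₃ • p + c • s).prod (l₂ • q - b • s)

lemma det_planeTransportDeriv {a b c : ℝ} (h : a + b + c = 1) (l₁ l₂ l₃ : ℝ) :
    (planeTransportDeriv b c l₁ l₂ l₃).det = a * (l₂ * l₃) + b * (l₁ * l₃) + c * (l₁ * l₂) := by
  have ha : a = 1 - b - c := by linarith
  rw [ContinuousLinearMap.det, ← LinearMap.det_toMatrix (Module.Basis.finTwoProd ℝ),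
    Matrix.det_fin_two]
  simp [LinearMap.toMatrix_apply, planeTransportDeriv, ha]
  ring

/-- Weighted AM-GM for l₂l₃, l₁l₃, l₁l₂ with weights a, b, c. The exponent of l₁ in the geometric
mean is b + c = 1 - a, exactly the one in the trilinear form, and likewise for the others. -/
lemma le_det_planeTransportDeriv {a b c : ℝ} (h : YoungWeights a b c) {l₁ l₂ l₃ : ℝ}
    (h₁ : 0 < l₁) (h₂ : 0 < l₂) (h₃ : 0 < l₃) :
    l₁ ^ (1 - a) * l₂ ^ (1 - b) * l₃ ^ (1 - c) ≤ (planeTransportDeriv b c l₁ l₂ l₃).det := by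
  rw [det_planeTransportDeriv h.sum_eq]
  have key := Real.geom_mean_le_arith_mean3_weighted h.a_pos.le h.b_pos.le h.c_pos.le
    (mul_pos h₂ h₃).le (mul_pos h₁ h₃).le (mul_pos h₁ h₂).le h.sum_eq
  refine le_of_eq_of_le ?_ key
  rw [Real.mul_rpow h₂.le h₃.le, Real.mul_rpow h₁.le h₃.le, Real.mul_rpow h₁.le h₂.le,
    show 1 - a = b + c by linarith [h.sum_eq], show 1 - b = a + c by linarith [h.sum_eq],
    show 1 - c = a + b by linarith [h.sum_eq], Real.rpow_add h₁, Real.rpow_add h₂,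
    Real.rpow_add h₃]
  ring

/-- The defect of additivity of three transport maps. -/
def transportDefect (T₁ T₂ T₃ : ℝ → ℝ) (z : ℝ × ℝ) : ℝ := T₁ (z.1 - z.2) + T₂ z.2 - T₃ z.1

/-- The plane map built from three transport maps on the line. -/
def planeTransport (b c : ℝ) (T₁ T₂ T₃ : ℝ → ℝ) (z : ℝ × ℝ) : ℝ × ℝ :=
  (T₃ z.1 + c * transportDefect T₁ T₂ T₃ z, T₂ z.2 - b * transportDefect T₁ T₂ T₃ z)

lemma hasFDerivAt_planeTransport {b c : ℝ} {T₁ T₂ T₃ : ℝ → ℝ} {z : ℝ × ℝ} {l₁ l₂ l₃ : ℝ}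
    (h₁ : HasDerivAt T₁ l₁ (z.1 - z.2)) (h₂ : HasDerivAt T₂ l₂ z.2)
    (h₃ : HasDerivAt T₃ l₃ z.1) :
    HasFDerivAt (planeTransport b c T₁ T₂ T₃) (planeTransportDeriv b c l₁ l₂ l₃) z := by
  have e₁ : HasFDerivAt (fun z : ℝ × ℝ => T₁ (z.1 - z.2))
      (l₁ • (ContinuousLinearMap.fst ℝ ℝ ℝ - ContinuousLinearMap.snd ℝ ℝ ℝ)) z :=
    h₁.comp_hasFDerivAt z (f := fun z : ℝ × ℝ => z.1 - z.2) (hasFDerivAt_fst.sub hasFDerivAt_snd)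
  have e₂ : HasFDerivAt (fun z : ℝ × ℝ => T₂ z.2) (l₂ • ContinuousLinearMap.snd ℝ ℝ ℝ) z :=
    h₂.comp_hasFDerivAt z (f := fun z : ℝ × ℝ => z.2) hasFDerivAt_snd
  have e₃ : HasFDerivAt (fun z : ℝ × ℝ => T₃ z.1) (l₃ • ContinuousLinearMap.fst ℝ ℝ ℝ) z :=
    h₃.comp_hasFDerivAt z (f := fun z : ℝ × ℝ => z.1) hasFDerivAt_fst
  have es := (e₁.add e₂).sub e₃
  exact (e₃.add (es.const_mul c)).prodMk (e₂.sub (es.const_mul b))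

/-- Points where transport maps with monotone left inverses are well behaved. -/
lemma injOn_planeTransport {a b c : ℝ} (h : YoungWeights a b c) {T₁ T₂ T₃ R₁ R₂ R₃ : ℝ → ℝ}
    {A₁ A₂ A₃ : Set ℝ} (m₁ : Monotone R₁) (m₂ : Monotone R₂) (m₃ : Monotone R₃)
    (e₁ : ∀ t ∈ A₁, R₁ (T₁ t) = t) (e₂ : ∀ t ∈ A₂, R₂ (T₂ t) = t)
    (e₃ : ∀ t ∈ A₃, R₃ (T₃ t) = t) :
    Set.InjOn (planeTransport b c T₁ T₂ T₃)
      {z : ℝ × ℝ | z.1 - z.2 ∈ A₁ ∧ z.2 ∈ A₂ ∧ z.1 ∈ A₃} := by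
  have mono : ∀ {T R : ℝ → ℝ} {A : Set ℝ}, Monotone R → (∀ t ∈ A, R (T t) = t) →
      ∀ s ∈ A, ∀ t ∈ A, T s ≤ T t → s ≤ t := by
    intro T R A hR e s hs t ht hst
    rw [← e s hs, ← e t ht]; exact hR hst
  -- The image point determines T₁ - as, T₂ - bs and T₃ + cs. Ordering two preimages by s therefore
  -- orders T₁ and T₂ the same way and T₃ the opposite way. Pulled back by the Rᵢ, these orders are
  -- compatible with x = (x - y) + y only if the points coincide.
  have aux : ∀ z ∈ {z : ℝ × ℝ | z.1 - z.2 ∈ A₁ ∧ z.2 ∈ A₂ ∧ z.1 ∈ A₃},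
      ∀ w ∈ {z : ℝ × ℝ | z.1 - z.2 ∈ A₁ ∧ z.2 ∈ A₂ ∧ z.1 ∈ A₃},
      planeTransport b c T₁ T₂ T₃ z = planeTransport b c T₁ T₂ T₃ w →
      transportDefect T₁ T₂ T₃ z ≤ transportDefect T₁ T₂ T₃ w →
      z.1 - z.2 ≤ w.1 - w.2 ∧ z.2 ≤ w.2 ∧ w.1 ≤ z.1 := by
    rintro z ⟨hz₁, hz₂, hz₃⟩ w ⟨hw₁, hw₂, hw₃⟩ heq hle
    simp only [planeTransport, Prod.mk.injEq] at heq
    obtain ⟨h₃, h₂⟩ := heq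
    have d₂ : T₂ z.2 ≤ T₂ w.2 := by nlinarith [mul_le_mul_of_nonneg_left hle h.b_pos.le]
    have d₃ : T₃ w.1 ≤ T₃ z.1 := by nlinarith [mul_le_mul_of_nonneg_left hle h.c_pos.le]
    have d₁ : T₁ (z.1 - z.2) ≤ T₁ (w.1 - w.2) := by
      have h₁ : T₁ (z.1 - z.2) - a * transportDefect T₁ T₂ T₃ z
          = T₁ (w.1 - w.2) - a * transportDefect T₁ T₂ T₃ w := by
        have ha : a = 1 - b - c := by linarith [h.sum_eq]
        rw [ha]
        simp only [transportDefect] at *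
        linarith
      nlinarith [mul_le_mul_of_nonneg_left hle h.a_pos.le]
    exact ⟨mono m₁ e₁ _ hz₁ _ hw₁ d₁, mono m₂ e₂ _ hz₂ _ hw₂ d₂, mono m₃ e₃ _ hw₃ _ hz₃ d₃⟩
  intro z hz w hw heq
  rcases le_total (transportDefect T₁ T₂ T₃ z) (transportDefect T₁ T₂ T₃ w) with hle | hle
  · obtain ⟨h1, h2, h3⟩ := aux z hz w hw heq hle
    exact Prod.ext (by linarith) (by linarith)
  · obtain ⟨h1, h2, h3⟩ := aux w hw z hz heq.symm hle
    exact Prod.ext (by linarith) (by linarith)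

/-- The vector (a, b, -c) is normal to t₁ + t₂ = t₃ for the form t₁²/a + t₂²/b + t₃²/c and has norm²
a + b + c = 1. Projecting along it lowers the form by exactly s², which produces the last factor;
the derivatives are absorbed by the Jacobian bound. -/
lemma young_pointwise {a b c : ℝ} (h : YoungWeights a b c) {T₁ T₂ T₃ : ℝ → ℝ} {l₁ l₂ l₃ : ℝ}
    {f₁ f₂ f₃ : ℝ → ℝ≥0∞} {z : ℝ × ℝ} (h₁ : 0 < l₁) (h₂ : 0 < l₂) (h₃ : 0 < l₃)
    (e₁ : f₁ (z.1 - z.2) = ENNReal.ofReal (l₁ * youngDensity a (T₁ (z.1 - z.2))))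
    (e₂ : f₂ z.2 = ENNReal.ofReal (l₂ * youngDensity b (T₂ z.2)))
    (e₃ : f₃ z.1 = ENNReal.ofReal (l₃ * youngDensity c (T₃ z.1))) :
    youngForm a b c f₁ f₂ f₃ z ≤ ENNReal.ofReal |(planeTransportDeriv b c l₁ l₂ l₃).det| *
      youngGauss a b c (planeTransport b c T₁ T₂ T₃ z) *
      ENNReal.ofReal (Real.exp (-(transportDefect T₁ T₂ T₃ z ^ 2) / 2)) := by
  have p₁ := youngDensity_pos h.a_pos h.a_lt (T₁ (z.1 - z.2))
  have p₂ := youngDensity_pos h.b_pos h.b_lt (T₂ z.2)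
  have p₃ := youngDensity_pos h.c_pos h.c_lt (T₃ z.1)
  have hk := h.const_pos
  rw [youngForm, e₁, e₂, e₃, ofReal_prod_rpow h (mul_pos h₁ p₁).le (mul_pos h₂ p₂).le
    (mul_pos h₃ p₃).le, Real.mul_rpow h₁.le p₁.le, Real.mul_rpow h₂.le p₂.le,
    Real.mul_rpow h₃.le p₃.le, youngGauss_eq h, ← ENNReal.ofReal_mul (abs_nonneg _),
    ← ENNReal.ofReal_mul (by positivity)]
  apply ENNReal.ofReal_le_ofReal
  have e : ∀ x y z u v w : ℝ, x * u * (y * v) * (z * w) = x * y * z * (u * v * w) := by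
    intros; ring
  rw [e, youngDensity_prod h, mul_assoc |_| _ _, mul_assoc (youngGaussConst a b c) _ _,
    ← Real.exp_add]
  have hexp : -(((planeTransport b c T₁ T₂ T₃ z).1 - (planeTransport b c T₁ T₂ T₃ z).2) ^ 2 / a
      + (planeTransport b c T₁ T₂ T₃ z).2 ^ 2 / b + (planeTransport b c T₁ T₂ T₃ z).1 ^ 2 / c) / 2
      + -(transportDefect T₁ T₂ T₃ z ^ 2) / 2
      = -(T₁ (z.1 - z.2) ^ 2 / a + T₂ z.2 ^ 2 / b + T₃ z.1 ^ 2 / c) / 2 := by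
    have hd : (planeTransport b c T₁ T₂ T₃ z).1 - (planeTransport b c T₁ T₂ T₃ z).2
        = T₁ (z.1 - z.2) - a * transportDefect T₁ T₂ T₃ z := by
      have ha : a = 1 - b - c := by linarith [h.sum_eq]
      simp only [planeTransport, transportDefect, ha]; ring
    have hs : T₁ (z.1 - z.2) = transportDefect T₁ T₂ T₃ z - T₂ z.2 + T₃ z.1 := by
      simp only [transportDefect]; ring
    rw [hd]
    simp only [planeTransport]
    rw [hs]
    set s := transportDefect T₁ T₂ T₃ z
    have ha := h.a_pos.ne'; have hb := h.b_pos.ne'; have hc := h.c_pos.ne'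
    have e1 : (s - T₂ z.2 + T₃ z.1 - a * s) ^ 2 / a
        = (s - T₂ z.2 + T₃ z.1) ^ 2 / a - 2 * s * (s - T₂ z.2 + T₃ z.1) + a * s ^ 2 := by
      field_simp; ring
    have e2 : (T₂ z.2 - b * s) ^ 2 / b = T₂ z.2 ^ 2 / b - 2 * s * T₂ z.2 + b * s ^ 2 := by
      field_simp; ring
    have e3 : (T₃ z.1 + c * s) ^ 2 / c = T₃ z.1 ^ 2 / c + 2 * s * T₃ z.1 + c * s ^ 2 := by
      field_simp; ring
    rw [e1, e2, e3]
    have hcs : c * s ^ 2 = s ^ 2 - a * s ^ 2 - b * s ^ 2 := by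
      rw [show c = 1 - a - b by linarith [h.sum_eq]]; ring
    rw [hcs]; ring
  rw [hexp]
  exact mul_le_mul_of_nonneg_right ((le_det_planeTransportDeriv h h₁ h₂ h₃).trans (le_abs_self _))
    (by positivity)

lemma measurePreserving_sub_snd :
    MeasurePreserving (fun z : ℝ × ℝ => (z.1 - z.2, z.2)) volume volume :=
  measurePreserving_sub_prod (volume : Measure ℝ) (volume : Measure ℝ)

lemma quasiMeasurePreserving_sub' :
    Measure.QuasiMeasurePreserving (fun z : ℝ × ℝ => z.1 - z.2) volume volume :=
  (Measure.quasiMeasurePreserving_fst (μ := (volume : Measure ℝ))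
    (ν := (volume : Measure ℝ))).comp measurePreserving_sub_snd.quasiMeasurePreserving

lemma setLIntegral_eq_of_ae_mem {E : Type*} [MeasurableSpace E] {μ : Measure E} {S : Set E}
    (mS : MeasurableSet S) {f : E → ℝ≥0∞} (h : ∀ᵐ z ∂μ, f z ≠ 0 → z ∈ S) :
    ∫⁻ z in S, f z ∂μ = ∫⁻ z, f z ∂μ := by
  rw [← lintegral_indicator mS]
  refine lintegral_congr_ae ?_
  filter_upwards [h] with z hz
  by_cases h0 : f z = 0
  · simp [h0]
  · exact Set.indicator_of_mem (hz h0) f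

/-- The common input of the inequality and of its equality case: on S all three transports are
differentiable and invertible, so the plane map admits a change of variables, with J its Jacobian.
The left inverses Rᵢ are kept for the equality case. -/
theorem exists_planeTransport {a b c : ℝ} (h : YoungWeights a b c) {f₁ f₂ f₃ : ℝ → ℝ≥0∞}
    (hf₁ : Measurable f₁) (hf₂ : Measurable f₂) (hf₃ : Measurable f₃)
    (i₁ : ∫⁻ t, f₁ t = 1) (i₂ : ∫⁻ t, f₂ t = 1) (i₃ : ∫⁻ t, f₃ t = 1) :
    ∃ (T₁ T₂ T₃ R₁ R₂ R₃ : ℝ → ℝ) (S : Set (ℝ × ℝ)) (J : ℝ × ℝ → ℝ≥0∞),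
      (Monotone R₁ ∧ Monotone R₂ ∧ Monotone R₃) ∧ MeasurableSet S ∧
      MeasurableSet (planeTransport b c T₁ T₂ T₃ '' S) ∧
      AEMeasurable J (volume.restrict S) ∧
      AEMeasurable (planeTransport b c T₁ T₂ T₃) (volume.restrict S) ∧
      (∀ᵐ z, youngForm a b c f₁ f₂ f₃ z ≠ 0 → z ∈ S) ∧
      (∀ g : ℝ × ℝ → ℝ≥0∞, ∫⁻ w in planeTransport b c T₁ T₂ T₃ '' S, g w
        = ∫⁻ z in S, J z * g (planeTransport b c T₁ T₂ T₃ z)) ∧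
      ∀ z ∈ S, (J z ≠ 0 ∧ J z ≠ ∞) ∧
        youngForm a b c f₁ f₂ f₃ z ≤ J z * youngGauss a b c (planeTransport b c T₁ T₂ T₃ z) *
          ENNReal.ofReal (Real.exp (-(transportDefect T₁ T₂ T₃ z ^ 2) / 2)) ∧
        R₁ (T₁ (z.1 - z.2)) = z.1 - z.2 ∧ R₂ (T₂ z.2) = z.2 ∧ R₃ (T₃ z.1) = z.1 := by
  have tr : ∀ {a : ℝ} {f : ℝ → ℝ≥0∞}, 0 < a → a < 1 → Measurable f → ∫⁻ t, f t = 1 →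
      ∃ (T T' R : ℝ → ℝ) (A : Set ℝ), MeasurableSet A ∧ Monotone R ∧ (∀ᵐ t, f t ≠ 0 → t ∈ A) ∧
      ∀ t ∈ A, HasDerivAt T (T' t) t ∧ 0 < T' t ∧
        f t = ENNReal.ofReal (T' t * youngDensity a (T t)) ∧ R (T t) = t := by
    intro a f h0 h1 hf hi
    refine exists_monotone_transport hf hi (continuous_youngDensity a)
      (integrable_gaussianPDFReal _ _) (youngDensity_pos h0 h1)
      (integral_gaussianPDFReal_eq_one _ ?_)
    rw [ne_eq, Real.toNNReal_eq_zero, not_le]; exact mul_pos h0 (by linarith)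
  obtain ⟨T₁, D₁, R₁, A₁, mA₁, mR₁, hA₁, H₁⟩ := tr h.a_pos h.a_lt hf₁ i₁
  obtain ⟨T₂, D₂, R₂, A₂, mA₂, mR₂, hA₂, H₂⟩ := tr h.b_pos h.b_lt hf₂ i₂
  obtain ⟨T₃, D₃, R₃, A₃, mA₃, mR₃, hA₃, H₃⟩ := tr h.c_pos h.c_lt hf₃ i₃
  set S : Set (ℝ × ℝ) := {z | z.1 - z.2 ∈ A₁ ∧ z.2 ∈ A₂ ∧ z.1 ∈ A₃} with hS
  set Θ' : ℝ × ℝ → (ℝ × ℝ →L[ℝ] ℝ × ℝ) := fun z =>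
    planeTransportDeriv b c (D₁ (z.1 - z.2)) (D₂ z.2) (D₃ z.1) with hΘ'
  have mS : MeasurableSet S :=
    ((measurable_fst.sub measurable_snd) mA₁).inter ((measurable_snd mA₂).inter
      (measurable_fst mA₃))
  have hd : ∀ z ∈ S, HasFDerivWithinAt (planeTransport b c T₁ T₂ T₃) (Θ' z) S z := fun z hz =>
    (hasFDerivAt_planeTransport (H₁ _ hz.1).1 (H₂ _ hz.2.1).1 (H₃ _ hz.2.2).1).hasFDerivWithinAt
  have hinj : Set.InjOn (planeTransport b c T₁ T₂ T₃) S :=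
    injOn_planeTransport h mR₁ mR₂ mR₃ (fun t ht => (H₁ t ht).2.2.2)
      (fun t ht => (H₂ t ht).2.2.2) (fun t ht => (H₃ t ht).2.2.2)
  refine ⟨T₁, T₂, T₃, R₁, R₂, R₃, S, fun z => ENNReal.ofReal |(Θ' z).det|, ⟨mR₁, mR₂, mR₃⟩, mS,
    measurable_image_of_fderivWithin mS hd hinj,
    aemeasurable_ofReal_abs_det_fderivWithin volume mS hd, ?_, ?_, ?_, ?_⟩
  · have hc : ContinuousOn (planeTransport b c T₁ T₂ T₃) S := fun z hz =>
      (hd z hz).continuousWithinAt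
    exact hc.aemeasurable mS
  -- Null sets of the line pull back to null sets of the plane along all three linear forms, and the
  -- exponents are positive, so the form vanishes wherever one density does.
  · filter_upwards [quasiMeasurePreserving_sub'.ae hA₁,
      (Measure.quasiMeasurePreserving_snd (μ := (volume : Measure ℝ))
        (ν := (volume : Measure ℝ))).ae hA₂,
      (Measure.quasiMeasurePreserving_fst (μ := (volume : Measure ℝ))
        (ν := (volume : Measure ℝ))).ae hA₃] with z h₁ h₂ h₃ hz
    refine ⟨h₁ fun h0 => hz ?_, h₂ fun h0 => hz ?_, h₃ fun h0 => hz ?_⟩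
    · rw [youngForm, h0, ENNReal.zero_rpow_of_pos (by linarith [h.a_lt])]; simp
    · rw [youngForm, h0, ENNReal.zero_rpow_of_pos (by linarith [h.b_lt])]; simp
    · rw [youngForm, h0, ENNReal.zero_rpow_of_pos (by linarith [h.c_lt])]; simp
  · exact fun g => lintegral_image_eq_lintegral_abs_det_fderiv_mul volume mS hd hinj g
  · rintro z ⟨hz₁, hz₂, hz₃⟩
    obtain ⟨-, p₁, e₁, r₁⟩ := H₁ _ hz₁
    obtain ⟨-, p₂, e₂, r₂⟩ := H₂ _ hz₂
    obtain ⟨-, p₃, e₃, r₃⟩ := H₃ _ hz₃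
    refine ⟨⟨?_, ENNReal.ofReal_ne_top⟩, young_pointwise h p₁ p₂ p₃ e₁ e₂ e₃, r₁, r₂, r₃⟩
    rw [ne_eq, ENNReal.ofReal_eq_zero, not_le, abs_pos]
    refine ((lt_of_lt_of_le ?_ (le_det_planeTransportDeriv h p₁ p₂ p₃))).ne'
    positivity

lemma ofReal_exp_le_one {s : ℝ} : ENNReal.ofReal (Real.exp (-(s ^ 2) / 2)) ≤ 1 := by
  rw [ENNReal.ofReal_le_one, Real.exp_le_one_iff]; nlinarith [sq_nonneg s]

/-- **The sharp trilinear Young inequality** for probability densities. -/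
theorem lintegral_youngForm_le {a b c : ℝ} (h : YoungWeights a b c) {f₁ f₂ f₃ : ℝ → ℝ≥0∞}
    (hf₁ : Measurable f₁) (hf₂ : Measurable f₂) (hf₃ : Measurable f₃)
    (i₁ : ∫⁻ t, f₁ t = 1) (i₂ : ∫⁻ t, f₂ t = 1) (i₃ : ∫⁻ t, f₃ t = 1) :
    ∫⁻ z, youngForm a b c f₁ f₂ f₃ z ≤ ∫⁻ w, youngGauss a b c w := by
  obtain ⟨T₁, T₂, T₃, R₁, R₂, R₃, S, J, -, mS, -, -, -, hF, hcv, hz⟩ :=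
    exists_planeTransport h hf₁ hf₂ hf₃ i₁ i₂ i₃
  rw [← setLIntegral_eq_of_ae_mem mS hF]
  calc ∫⁻ z in S, youngForm a b c f₁ f₂ f₃ z
      ≤ ∫⁻ z in S, J z * youngGauss a b c (planeTransport b c T₁ T₂ T₃ z) := by
        refine setLIntegral_mono' mS fun z hzS => (hz z hzS).2.1.trans ?_
        exact mul_le_of_le_one_right' ofReal_exp_le_one
    _ = ∫⁻ w in planeTransport b c T₁ T₂ T₃ '' S, youngGauss a b c w := (hcv _).symm
    _ ≤ ∫⁻ w, youngGauss a b c w := setLIntegral_le_lintegral _ _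

/-- **Extremals of the trilinear Young inequality**: the extremal integrand is an affine image of
the Gaussian one. -/
theorem exists_map_of_lintegral_youngForm_eq {a b c : ℝ} (h : YoungWeights a b c)
    {f₁ f₂ f₃ : ℝ → ℝ≥0∞}
    (hf₁ : Measurable f₁) (hf₂ : Measurable f₂) (hf₃ : Measurable f₃)
    (i₁ : ∫⁻ t, f₁ t = 1) (i₂ : ∫⁻ t, f₂ t = 1) (i₃ : ∫⁻ t, f₃ t = 1)
    (hfin : ∫⁻ w, youngGauss a b c w ≠ ∞)
    (heq : ∫⁻ z, youngForm a b c f₁ f₂ f₃ z = ∫⁻ w, youngGauss a b c w) :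
    ∃ (l : ℝ) (m : ℝ × ℝ), volume.withDensity (youngForm a b c f₁ f₂ f₃)
      = (volume.withDensity (youngGauss a b c)).map fun w => l • w + m := by
  obtain ⟨T₁, T₂, T₃, R₁, R₂, R₃, S, J, ⟨mR₁, mR₂, mR₃⟩, mS, mΘS, mJ, mΘ, hF, hcv, hz⟩ :=
    exists_planeTransport h hf₁ hf₂ hf₃ i₁ i₂ i₃
  set F := youngForm a b c f₁ f₂ f₃ with hFdef
  set Γ := youngGauss a b c with hΓ
  set Θ := planeTransport b c T₁ T₂ T₃ with hΘ
  have mΓ : Measurable Γ := measurable_youngGauss a b c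
  have hFS : ∫⁻ z in S, F z = ∫⁻ w, Γ w := by
    rw [setLIntegral_eq_of_ae_mem mS hF, heq]
  have hle : ∀ z ∈ S, F z ≤ J z * Γ (Θ z) := fun z hzS =>
    (hz z hzS).2.1.trans (mul_le_of_le_one_right' ofReal_exp_le_one)
  have hupper : ∫⁻ z in S, J z * Γ (Θ z) ≤ ∫⁻ w, Γ w := by
    rw [← hcv Γ]; exact setLIntegral_le_lintegral _ _
  -- Equality of the finite integrals turns the pointwise inequality into an almost everywhere
  -- equality.
  have hae : F =ᵐ[volume.restrict S] fun z => J z * Γ (Θ z) := by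
    refine ae_eq_of_ae_le_of_lintegral_le ?_ (by rw [hFS]; exact hfin)
      (mJ.mul (mΓ.comp_aemeasurable mΘ)) (by rw [hFS]; exact hupper)
    filter_upwards [ae_restrict_mem mS] with z hzS using hle z hzS
  -- There is no room left for a factor exp(-s²/2) < 1, since J and Γ are nonzero and finite.
  have hdefect : ∀ᵐ z ∂(volume.restrict S), transportDefect T₁ T₂ T₃ z = 0 := by
    filter_upwards [hae, ae_restrict_mem mS] with z h1 hzS
    obtain ⟨⟨j0, j1⟩, h2, -⟩ := hz z hzS
    rw [h1] at h2
    by_contra hne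
    have hlt : ENNReal.ofReal (Real.exp (-(transportDefect T₁ T₂ T₃ z ^ 2) / 2)) < 1 := by
      rw [ENNReal.ofReal_lt_one, Real.exp_lt_one_iff]
      have := sq_pos_of_ne_zero hne
      linarith
    have hG0 : J z * Γ (Θ z) ≠ 0 := mul_ne_zero j0 (youngGauss_ne_zero h _)
    have hG1 : J z * Γ (Θ z) ≠ ∞ := ENNReal.mul_ne_top j1 (youngGauss_ne_top h _)
    have := ENNReal.mul_lt_mul_right hG0 hG1 hlt
    rw [mul_one] at this
    exact absurd h2 (not_le.2 this)
  have hfull : ∫⁻ w in Θ '' S, Γ w = ∫⁻ w, Γ w := by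
    rw [hcv Γ]
    exact le_antisymm hupper (hFS ▸ setLIntegral_mono' mS hle)
  -- Γ is positive everywhere, so a set it does not charge is Lebesgue null.
  have hnull : volume (Θ '' S)ᶜ = 0 := by
    have h0 : ∫⁻ w in (Θ '' S)ᶜ, Γ w = 0 := by
      have := lintegral_add_compl Γ mΘS (μ := volume)
      rw [hfull] at this
      exact (ENNReal.add_right_inj hfin).1 (this.trans (add_zero _).symm)
    rw [lintegral_eq_zero_iff mΓ] at h0
    rw [← Measure.restrict_eq_zero, ← ae_eq_bot]
    refine Filter.eventually_false_iff_eq_bot.1 ?_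
    filter_upwards [h0] with w hw using youngGauss_ne_zero h w hw
  -- Where s = 0 the image is (T₃ x, T₂ y) with difference T₁(x-y), so the relation reads x - y = x
  -- - y. The change of variables moves it to almost every point of the image, which has full
  -- measure.
  have hfunc : ∀ᵐ w : ℝ × ℝ, R₁ (w.1 - w.2) = R₃ w.1 - R₂ w.2 := by
    set B : Set (ℝ × ℝ) := {w | ¬ R₁ (w.1 - w.2) = R₃ w.1 - R₂ w.2}
    have mB : MeasurableSet B := (measurableSet_eq_fun
      (mR₁.measurable.comp (measurable_fst.sub measurable_snd))
      ((mR₃.measurable.comp measurable_fst).sub (mR₂.measurable.comp measurable_snd))).compl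
    have h0 : ∫⁻ w in Θ '' S, B.indicator 1 w = 0 := by
      rw [hcv, lintegral_eq_zero_iff' (f := fun z => J z * B.indicator 1 (Θ z)) (mJ.mul
        ((measurable_one.indicator mB).comp_aemeasurable mΘ))]
      filter_upwards [hdefect, ae_restrict_mem mS] with z hd hzS
      obtain ⟨-, -, r₁, r₂, r₃⟩ := hz z hzS
      have : Θ z ∉ B := by
        simp only [B, Set.mem_ofPred_eq, not_not, hΘ, planeTransport, hd, mul_zero, add_zero,
          sub_zero, r₂, r₃]
        rw [← r₁]
        congr 1
        simp only [transportDefect] at hd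
        linarith
      simp [this]
    rw [lintegral_indicator_one mB, Measure.restrict_apply mB] at h0
    refine measure_mono_null (fun w hw => ?_) (measure_union_null h0 hnull)
    by_cases hw' : w ∈ Θ '' S
    · exact Or.inl ⟨hw, hw'⟩
    · exact Or.inr hw'
  obtain ⟨l, b₂, b₃, hR₃, hR₂⟩ := exists_affine_of_ae_sub_eq mR₁ mR₂ mR₃ hfunc
  refine ⟨l, (b₃, b₂), ?_⟩
  have hmaff : Measurable fun w : ℝ × ℝ => l • w + (b₃, b₂) := by fun_prop
  ext B mB
  rw [Measure.map_apply hmaff mB, withDensity_apply _ mB, withDensity_apply _ (hmaff mB),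
    ← lintegral_indicator mB, ← lintegral_indicator (hmaff mB)]
  have e1 : ∫⁻ z, B.indicator F z = ∫⁻ z in S, B.indicator F z := by
    refine (setLIntegral_eq_of_ae_mem mS ?_).symm
    filter_upwards [hF] with z hz hz2
    exact hz fun h0 => hz2 (by simp [h0])
  have e2 : ∫⁻ w, ((fun w : ℝ × ℝ => l • w + (b₃, b₂)) ⁻¹' B).indicator Γ w
      = ∫⁻ w in Θ '' S, ((fun w : ℝ × ℝ => l • w + (b₃, b₂)) ⁻¹' B).indicator Γ w := by
    refine (setLIntegral_eq_of_ae_mem mΘS ?_).symm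
    filter_upwards [measure_eq_zero_iff_ae_notMem.1 hnull] with w hw _
    simpa using hw
  rw [e1, e2, hcv]
  refine lintegral_congr_ae ?_
  filter_upwards [hdefect, hae, ae_restrict_mem mS] with z hd h1 hzS
  obtain ⟨-, -, -, r₂, r₃⟩ := hz z hzS
  -- The affine formulas for R₃ and R₂ invert the plane map, with a single scalar l for both
  -- coordinates.
  have hzz : l • Θ z + (b₃, b₂) = z := by
    simp only [hΘ, planeTransport, hd, mul_zero, add_zero, sub_zero]
    rw [hR₃] at r₃; rw [hR₂] at r₂
    exact Prod.ext (by simpa using r₃) (by simpa using r₂)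
  by_cases hzB : z ∈ B
  · have : Θ z ∈ (fun w : ℝ × ℝ => l • w + (b₃, b₂)) ⁻¹' B := by
      rw [Set.mem_preimage, hzz]; exact hzB
    rw [Set.indicator_of_mem hzB, Set.indicator_of_mem this, h1]
  · have : Θ z ∉ (fun w : ℝ × ℝ => l • w + (b₃, b₂)) ⁻¹' B := by
      rw [Set.mem_preimage, hzz]; exact hzB
    rw [Set.indicator_of_notMem hzB, Set.indicator_of_notMem this, mul_zero]

/-! ### The Gaussian extremals -/

lemma map_withDensity_comp_of_measurePreserving {E : Type*} [MeasurableSpace E] {μ : Measure E}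
    {e : E → E} (he : MeasurePreserving e μ μ) {g : E → ℝ≥0∞} (hg : Measurable g) :
    (μ.withDensity (g ∘ e)).map e = μ.withDensity g := by
  ext B hB
  rw [Measure.map_apply he.measurable hB, withDensity_apply _ (he.measurable hB),
    withDensity_apply _ hB]
  exact he.setLIntegral_comp_preimage hB hg

lemma measurePreserving_shear (k : ℝ) :
    MeasurePreserving (fun z : ℝ × ℝ => (z.1 + k * z.2, z.2)) volume volume := by
  have h1 : MeasurePreserving (fun p : ℝ × ℝ => (p.1, p.2 + k * p.1))
      ((volume : Measure ℝ).prod volume) ((volume : Measure ℝ).prod volume) :=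
    (MeasurePreserving.id (volume : Measure ℝ)).skew_product (g := fun y x => x + k * y)
      (by fun_prop) (Filter.Eventually.of_forall fun y =>
        (measurePreserving_add_right volume (k * y)).map_eq)
  have hs : MeasurePreserving Prod.swap ((volume : Measure ℝ).prod volume)
    ((volume : Measure ℝ).prod volume) := Measure.measurePreserving_swap
  exact (hs.comp h1).comp hs

/-- The sharp constant in terms of the weights. -/
noncomputable def youngSharp (a b c : ℝ) : ℝ :=
  Real.exp ((a * Real.log a - (1 - a) * Real.log (1 - a) + (b * Real.log b
    - (1 - b) * Real.log (1 - b)) + (c * Real.log c - (1 - c) * Real.log (1 - c))) / 2)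

lemma youngSharp_pos (a b c : ℝ) : 0 < youngSharp a b c := Real.exp_pos _

lemma log_gaussianPDFReal (m : ℝ) {v : ℝ} (hv : 0 < v) (x : ℝ) :
    Real.log (gaussianPDFReal m v.toNNReal x)
      = -(Real.log (2 * Real.pi) + Real.log v) / 2 - (x - m) ^ 2 / (2 * v) := by
  have := Real.pi_pos
  rw [gaussianPDFReal, Real.coe_toNNReal _ hv.le, Real.log_mul (by positivity)
    (Real.exp_pos _).ne', Real.log_exp, Real.log_inv, Real.log_sqrt (by positivity),
    Real.log_mul (by positivity) hv.ne']
  ring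

lemma gaussianPDFReal_toNNReal_pos (m : ℝ) {v : ℝ} (hv : 0 < v) (x : ℝ) :
    0 < gaussianPDFReal m v.toNNReal x :=
  gaussianPDFReal_pos _ _ _ (by rwa [ne_eq, Real.toNNReal_eq_zero, not_le])

/-- Completing the square: c/(1-b) is the regression coefficient of x on y for the extremal
covariance, and v·ac/(1-b) is the residual variance. After logarithms, what remains of the constants
is the logarithm of the sharp constant. -/
lemma gaussianPDFReal_young_identity {a b c : ℝ} (h : YoungWeights a b c) {v : ℝ} (hv : 0 < v)
    (m n x y : ℝ) :
    gaussianPDFReal (m - n) (v * (a * (1 - a))).toNNReal (x - y) ^ (1 - a)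
      * gaussianPDFReal n (v * (b * (1 - b))).toNNReal y ^ (1 - b)
      * gaussianPDFReal m (v * (c * (1 - c))).toNNReal x ^ (1 - c)
    = youngSharp a b c * (gaussianPDFReal (m - c / (1 - b) * n) (v * (a * c / (1 - b))).toNNReal
        (x - c / (1 - b) * y) * gaussianPDFReal n (v * (b * (1 - b))).toNNReal y) := by
  have ha := h.a_pos; have hb := h.b_pos; have hc := h.c_pos
  have ha1 : 0 < 1 - a := by linarith [h.a_lt]
  have hb1 : 0 < 1 - b := by linarith [h.b_lt]
  have hc1 : 0 < 1 - c := by linarith [h.c_lt]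
  have q₁ := gaussianPDFReal_toNNReal_pos (m - n) (v := v * (a * (1 - a))) (by positivity) (x - y)
  have q₂ := gaussianPDFReal_toNNReal_pos n (v := v * (b * (1 - b))) (by positivity) y
  have q₃ := gaussianPDFReal_toNNReal_pos m (v := v * (c * (1 - c))) (by positivity) x
  have q₄ := gaussianPDFReal_toNNReal_pos (m - c / (1 - b) * n) (v := v * (a * c / (1 - b)))
    (by positivity) (x - c / (1 - b) * y)
  refine Real.log_injOn_pos (Set.mem_Ioi.2 (by positivity))
    (Set.mem_Ioi.2 (mul_pos (youngSharp_pos a b c) (by positivity))) ?_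
  rw [Real.log_mul (by positivity) (by positivity), Real.log_mul (by positivity) (by positivity),
    Real.log_rpow q₁, Real.log_rpow q₂, Real.log_rpow q₃,
    Real.log_mul (youngSharp_pos a b c).ne' (by positivity), Real.log_mul q₄.ne' q₂.ne',
    log_gaussianPDFReal _ (by positivity), log_gaussianPDFReal _ (by positivity),
    log_gaussianPDFReal _ (by positivity), log_gaussianPDFReal _ (by positivity),
    youngSharp, Real.log_exp]
  have quad : (x - y - (m - n)) ^ 2 / (2 * (v * a)) + (y - n) ^ 2 / (2 * (v * b))
      + (x - m) ^ 2 / (2 * (v * c))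
      = (x - c / (1 - b) * y - (m - c / (1 - b) * n)) ^ 2 / (2 * (v * (a * c / (1 - b))))
        + (y - n) ^ 2 / (2 * (v * (b * (1 - b)))) := by
    have e : x - c / (1 - b) * y - (m - c / (1 - b) * n) = (x - m) - c / (1 - b) * (y - n) := by
      ring
    rw [e, show x - y - (m - n) = (x - m) - (y - n) by ring]
    generalize x - m = X; generalize y - n = Y
    have h1b : 1 - b = a + c := by linarith [h.sum_eq]
    have hbb : b = 1 - a - c := by linarith [h.sum_eq]
    have hac : 0 < a + c := by positivity
    rw [h1b]
    field_simp
    rw [hbb]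
    ring
  have s₁ : ∀ {t u w : ℝ}, 0 < t → 0 < 1 - t →
      (1 - t) * (w - u / (2 * (v * (t * (1 - t))))) = (1 - t) * w - u / (2 * (v * t)) := by
    intro t u w ht ht1; rw [mul_sub]; congr 1; field_simp
  rw [s₁ ha ha1, s₁ hb hb1, s₁ hc hc1]
  rw [Real.log_mul hv.ne' (by positivity), Real.log_mul hv.ne' (by positivity),
    Real.log_mul hv.ne' (by positivity), Real.log_mul hv.ne' (by positivity),
    Real.log_mul ha.ne' ha1.ne', Real.log_mul hb.ne' hb1.ne', Real.log_mul hc.ne' hc1.ne',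
    Real.log_div (by positivity) hb1.ne', Real.log_mul ha.ne' hc.ne']
  -- The exponents on the left add up to the number of Gaussian densities on the right, so the terms
  -- in log(2π) and log v cancel.
  have hlin : (1 - a) + (1 - b) + (1 - c) = 2 := by linarith [h.sum_eq]
  generalize Real.log (2 * Real.pi) = P
  generalize Real.log v = V
  generalize Real.log (1 - a) = La'; generalize Real.log (1 - b) = Lb'
  generalize Real.log (1 - c) = Lc'
  generalize Real.log a = La; generalize Real.log b = Lb; generalize Real.log c = Lc
  have hcc : c = 1 - a - b := by linarith [h.sum_eq]
  linear_combination (-1 : ℝ) * quad - (P + V) / 2 * hlin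

/-- The Gaussian version of `youngForm`, as a multiple of a density of a Gaussian vector. -/
lemma youngForm_gaussianPDF {a b c : ℝ} (h : YoungWeights a b c) {v : ℝ} (hv : 0 < v)
    (m n : ℝ) (z : ℝ × ℝ) :
    youngForm a b c (gaussianPDF (m - n) (v * (a * (1 - a))).toNNReal)
      (gaussianPDF n (v * (b * (1 - b))).toNNReal) (gaussianPDF m (v * (c * (1 - c))).toNNReal) z
    = ENNReal.ofReal (youngSharp a b c) *
      (gaussianPDF (m - c / (1 - b) * n) (v * (a * c / (1 - b))).toNNReal
        (z.1 - c / (1 - b) * z.2) * gaussianPDF n (v * (b * (1 - b))).toNNReal z.2) := by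
  simp only [youngForm, gaussianPDF]
  rw [ofReal_prod_rpow h (gaussianPDFReal_nonneg _ _ _) (gaussianPDFReal_nonneg _ _ _)
    (gaussianPDFReal_nonneg _ _ _), gaussianPDFReal_young_identity h hv,
    ENNReal.ofReal_mul (youngSharp_pos a b c).le, ENNReal.ofReal_mul (gaussianPDFReal_nonneg _ _ _)]

/-- The covariance structure, up to the factor `v`, of the extremal Gaussian vectors. -/
structure YoungCovariance {Ω : Type*} [MeasurableSpace Ω] (P : Measure Ω) (X Y : Ω → ℝ)
    (b c v : ℝ) : Prop where
  left : Var[X; P] = v * (c * (1 - c))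
  right : Var[Y; P] = v * (b * (1 - b))
  cov : cov[X, Y; P] = v * (b * c)

/-- With k = cov(X,Y)/Var(Y), the Gaussian pair X - kY and Y is uncorrelated, hence independent with
product density. The measure-preserving shear carries this back to (X, Y), and completing the square
identifies the result. -/
lemma map_eq_withDensity_youngForm {Ω : Type*} [MeasurableSpace Ω] {P : Measure Ω}
    {X Y : Ω → ℝ} (hG : HasGaussianLaw (fun ω => (X ω, Y ω)) P) {a b c v : ℝ}
    (h : YoungWeights a b c) (hv : 0 < v) (hc : YoungCovariance P X Y b c v) :
    P.map (fun ω => (X ω, Y ω)) = volume.withDensity fun z =>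
      (ENNReal.ofReal (youngSharp a b c))⁻¹ *
      youngForm a b c (gaussianPDF (P[X] - P[Y]) (v * (a * (1 - a))).toNNReal)
        (gaussianPDF P[Y] (v * (b * (1 - b))).toNNReal)
        (gaussianPDF P[X] (v * (c * (1 - c))).toNNReal) z := by
  have := hG.isProbabilityMeasure
  have ha := h.a_pos; have hb := h.b_pos; have hcp := h.c_pos
  have hb1 : 0 < 1 - b := by linarith [h.b_lt]
  set k := c / (1 - b) with hk
  have hL : HasGaussianLaw (fun ω => (X ω - k * Y ω, Y ω)) P := by
    have := hG.map_fun (((ContinuousLinearMap.fst ℝ ℝ ℝ)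
      - k • (ContinuousLinearMap.snd ℝ ℝ ℝ)).prod (ContinuousLinearMap.snd ℝ ℝ ℝ))
    simpa using this
  have hX2 := hG.fst.memLp_two
  have hY2 := hG.snd.memLp_two
  have hkY2 : MemLp (fun ω => k * Y ω) 2 P := hY2.const_mul k
  have hcov : cov[fun ω => X ω - k * Y ω, Y; P] = 0 := by
    rw [covariance_fun_sub_left hX2 hkY2 hY2, covariance_const_mul_left,
      covariance_self hY2.aemeasurable, hc.cov, hc.right, hk]
    field_simp; ring
  have hvar : Var[fun ω => X ω - k * Y ω; P] = v * (a * c / (1 - b)) := by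
    rw [variance_fun_sub hX2 hkY2, covariance_const_mul_right, variance_const_mul,
      hc.cov, hc.left, hc.right, hk]
    have : a = 1 - b - c := by linarith [h.sum_eq]
    rw [this]
    field_simp; ring
  have hind := hL.indepFun_of_covariance_eq_zero hcov
  have hmap := (indepFun_iff_map_prod_eq_prod_map_map hL.fst.aemeasurable
    hL.snd.aemeasurable).1 hind
  rw [hL.fst.map_eq_gaussianReal, hL.snd.map_eq_gaussianReal, hvar, hc.right,
    integral_sub hG.fst.integrable (hG.snd.integrable.const_mul k), integral_const_mul,
    gaussianReal_of_var_ne_zero _ (by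
      rw [ne_eq, Real.toNNReal_eq_zero, not_le]; positivity),
    gaussianReal_of_var_ne_zero _ (by
      rw [ne_eq, Real.toNNReal_eq_zero, not_le]; positivity),
    prod_withDensity (measurable_gaussianPDF _ _) (measurable_gaussianPDF _ _)] at hmap
  have hS := measurePreserving_shear k
  have hcomp : P.map (fun ω => (X ω, Y ω))
      = (P.map fun ω => (X ω - k * Y ω, Y ω)).map fun z : ℝ × ℝ => (z.1 + k * z.2, z.2) := by
    rw [AEMeasurable.map_map_of_aemeasurable hS.measurable.aemeasurable hL.aemeasurable]
    congr 1; ext ω <;> simp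
  have hg : Measurable fun z : ℝ × ℝ => gaussianPDF (P[X] - k * P[Y])
      (v * (a * c / (1 - b))).toNNReal (z.1 - k * z.2)
        * gaussianPDF P[Y] (v * (b * (1 - b))).toNNReal z.2 := by
    have := measurable_gaussianPDF (P[X] - k * P[Y]) (v * (a * c / (1 - b))).toNNReal
    have := measurable_gaussianPDF P[Y] (v * (b * (1 - b))).toNNReal
    fun_prop
  rw [hcomp, hmap]
  have e1 := map_withDensity_comp_of_measurePreserving hS hg
  have e2 : (fun z : ℝ × ℝ => gaussianPDF (P[X] - k * P[Y])
      (v * (a * c / (1 - b))).toNNReal (z.1 - k * z.2)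
        * gaussianPDF P[Y] (v * (b * (1 - b))).toNNReal z.2) ∘ (fun z => (z.1 + k * z.2, z.2))
      = fun z : ℝ × ℝ => gaussianPDF (P[X] - k * P[Y])
      (v * (a * c / (1 - b))).toNNReal z.1
        * gaussianPDF P[Y] (v * (b * (1 - b))).toNNReal z.2 := by
    ext z; simp
  rw [e2] at e1
  refine e1.trans ?_
  congr 1
  ext z
  rw [youngForm_gaussianPDF h hv, ← mul_assoc (ENNReal.ofReal (youngSharp a b c))⁻¹,
    ENNReal.inv_mul_cancel (by simpa using youngSharp_pos a b c) ENNReal.ofReal_ne_top, one_mul]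

/-- The reference measure on the plane carrying the extremal Gaussian vector. -/
noncomputable def youngRef (a b c : ℝ) : Measure (ℝ × ℝ) :=
  (gaussianReal 0 (a * c / (1 - b)).toNNReal).prod (gaussianReal 0 (b * (1 - b)).toNNReal)

/-- The first component of the extremal Gaussian vector. -/
noncomputable def youngRefX (b c : ℝ) (z : ℝ × ℝ) : ℝ := z.1 + c / (1 - b) * z.2

instance (a b c : ℝ) : IsGaussian (youngRef a b c) := by unfold youngRef; infer_instance

lemma hasGaussianLaw_youngRef (a b c : ℝ) :
    HasGaussianLaw (fun z => (youngRefX b c z, z.2)) (youngRef a b c) := by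
  have := (IsGaussian.hasGaussianLaw_id (μ := youngRef a b c)).map_fun
    (((ContinuousLinearMap.fst ℝ ℝ ℝ)
      + (c / (1 - b)) • (ContinuousLinearMap.snd ℝ ℝ ℝ)).prod (ContinuousLinearMap.snd ℝ ℝ ℝ))
  simpa [youngRefX] using this

lemma integral_youngRef (a b c : ℝ) :
    ∫ z, z.1 ∂youngRef a b c = 0 ∧ ∫ z, z.2 ∂youngRef a b c = 0 := by
  constructor
  · rw [youngRef, integral_fun_fst (fun x : ℝ => x)]; simp
  · rw [youngRef, integral_fun_snd (fun x : ℝ => x)]; simp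

lemma youngCovariance_youngRef {a b c : ℝ} (h : YoungWeights a b c) :
    YoungCovariance (youngRef a b c) (youngRefX b c) Prod.snd b c 1 := by
  have ha := h.a_pos; have hb := h.b_pos; have hc := h.c_pos
  have hb1 : 0 < 1 - b := by linarith [h.b_lt]
  have hid := IsGaussian.hasGaussianLaw_id (μ := youngRef a b c)
  have h1 : HasGaussianLaw (fun z : ℝ × ℝ => z.1) (youngRef a b c) :=
    hid.map_fun (ContinuousLinearMap.fst ℝ ℝ ℝ)
  have h2 : HasGaussianLaw (fun z : ℝ × ℝ => z.2) (youngRef a b c) :=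
    hid.map_fun (ContinuousLinearMap.snd ℝ ℝ ℝ)
  have v1 : Var[fun z : ℝ × ℝ => z.1; youngRef a b c] = a * c / (1 - b) := by
    have := variance_fun_id_gaussianReal (μ := 0) (v := (a * c / (1 - b)).toNNReal)
    rw [Real.coe_toNNReal _ (by positivity)] at this
    rw [← this, ← (measurePreserving_fst (μ := gaussianReal 0 (a * c / (1 - b)).toNNReal)
      (ν := gaussianReal 0 (b * (1 - b)).toNNReal)).map_eq,
      variance_map (by fun_prop) (by fun_prop)]
    rfl
  have v2 : Var[fun z : ℝ × ℝ => z.2; youngRef a b c] = b * (1 - b) := by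
    have := variance_fun_id_gaussianReal (μ := 0) (v := (b * (1 - b)).toNNReal)
    rw [Real.coe_toNNReal _ (by positivity)] at this
    rw [← this, ← (measurePreserving_snd (μ := gaussianReal 0 (a * c / (1 - b)).toNNReal)
      (ν := gaussianReal 0 (b * (1 - b)).toNNReal)).map_eq,
      variance_map (by fun_prop) (by fun_prop)]
    rfl
  have cv : cov[fun z : ℝ × ℝ => z.1, fun z : ℝ × ℝ => z.2; youngRef a b c] = 0 := by
    have m1 : MemLp (fun x : ℝ => x) 2 (gaussianReal 0 (a * c / (1 - b)).toNNReal) :=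
      memLp_id_gaussianReal' 2 (by simp)
    have m2 : MemLp (fun x : ℝ => x) 2 (gaussianReal 0 (b * (1 - b)).toNNReal) :=
      memLp_id_gaussianReal' 2 (by simp)
    exact covariance_fst_snd_prod m1 m2
  have m1 := h1.memLp_two
  have m2 := h2.memLp_two
  have m3 : MemLp (fun z : ℝ × ℝ => c / (1 - b) * z.2) 2 (youngRef a b c) := m2.const_mul _
  have hX : youngRefX b c = (fun z : ℝ × ℝ => z.1) + fun z : ℝ × ℝ => c / (1 - b) * z.2 := rfl
  have hs : (Prod.snd : ℝ × ℝ → ℝ) = fun z => z.2 := rfl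
  refine ⟨?_, ?_, ?_⟩
  · rw [hX, variance_add m1 m3, covariance_const_mul_right, variance_const_mul, v1, v2, cv]
    have : a = 1 - b - c := by linarith [h.sum_eq]
    rw [this]; field_simp; ring
  · rw [hs, v2, one_mul]
  · rw [hX, hs, covariance_add_left m1 m3 m2, covariance_const_mul_left, cv,
      covariance_self m2.aemeasurable, v2]
    field_simp; ring

lemma youngGauss_eq_gaussianPDF (a b c : ℝ) :
    youngGauss a b c = youngForm a b c (gaussianPDF (0 - 0) (1 * (a * (1 - a))).toNNReal)
      (gaussianPDF 0 (1 * (b * (1 - b))).toNNReal)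
      (gaussianPDF 0 (1 * (c * (1 - c))).toNNReal) := by
  simp only [one_mul, sub_zero]
  rfl

/-- The law of the extremal Gaussian vector is proportional to the extremal integrand. -/
theorem withDensity_youngGauss {a b c : ℝ} (h : YoungWeights a b c) :
    volume.withDensity (youngGauss a b c) = ENNReal.ofReal (youngSharp a b c) •
      (youngRef a b c).map fun z => (youngRefX b c z, z.2) := by
  have hG := hasGaussianLaw_youngRef a b c
  have e := map_eq_withDensity_youngForm hG h one_pos (youngCovariance_youngRef h)
  have i2 : ∫ z, z.2 ∂youngRef a b c = 0 := (integral_youngRef a b c).2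
  have hid := IsGaussian.hasGaussianLaw_id (μ := youngRef a b c)
  have h1 : HasGaussianLaw (fun z : ℝ × ℝ => z.1) (youngRef a b c) :=
    hid.map_fun (ContinuousLinearMap.fst ℝ ℝ ℝ)
  have i1 : ∫ z, youngRefX b c z ∂youngRef a b c = 0 := by
    have : youngRefX b c = fun z : ℝ × ℝ => z.1 + c / (1 - b) * z.2 := rfl
    rw [this, integral_add h1.integrable (hG.snd.integrable.const_mul _), integral_const_mul,
      (integral_youngRef a b c).1, i2]; simp
  rw [i1, i2, ← youngGauss_eq_gaussianPDF] at e
  rw [e, ← withDensity_smul' _ _ ENNReal.ofReal_ne_top]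
  congr 1
  ext z
  simp only [Pi.smul_apply, smul_eq_mul]
  rw [← mul_assoc (ENNReal.ofReal (youngSharp a b c)),
    ENNReal.mul_inv_cancel (by simpa using youngSharp_pos a b c) ENNReal.ofReal_ne_top, one_mul]

/-- The extremal integrand is the sharp constant times a probability density, so its mass is read
off without computing a Gaussian integral. -/
theorem lintegral_youngGauss {a b c : ℝ} (h : YoungWeights a b c) :
    ∫⁻ w, youngGauss a b c w = ENNReal.ofReal (youngSharp a b c) := by
  have e := congrArg (fun μ => μ Set.univ) (withDensity_youngGauss h)
  have : IsProbabilityMeasure ((youngRef a b c).map fun z => (youngRefX b c z, z.2)) :=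
    Measure.isProbabilityMeasure_map (hasGaussianLaw_youngRef a b c).aemeasurable
  simpa using e

/-! ### Entropy -/

section Entropy

variable {Ω E : Type*} [MeasurableSpace Ω] [MeasureSpace E] {P : Measure Ω} {X : Ω → E}

lemma measurable_log_toReal {f : E → ℝ≥0∞} (hf : Measurable f) :
    Measurable fun x => Real.log (f x).toReal :=
  Real.measurable_log.comp hf.ennreal_toReal

lemma HasFiniteEntropy.integrable_log [IsProbabilityMeasure P] (h : HasFiniteEntropy X P) :
    Integrable (fun ω => Real.log (pdf X P volume (X ω)).toReal) P := by
  have := h.hasPDF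
  exact (pdf.integrable_pdf_smul_iff
    (measurable_log_toReal (measurable_pdf X P volume)).aestronglyMeasurable).1 h.integrable

lemma hasFiniteEntropy_of_integrable_log [IsProbabilityMeasure P] (h : HasPDF X P volume)
    (hi : Integrable (fun ω => Real.log (pdf X P volume (X ω)).toReal) P) :
    HasFiniteEntropy X P :=
  ⟨h, (pdf.integrable_pdf_smul_iff
    (measurable_log_toReal (measurable_pdf X P volume)).aestronglyMeasurable).2 hi⟩

lemma entropyS_eq_integral_log [IsProbabilityMeasure P] (h : HasPDF X P volume) :
    entropyS X P = ∫ ω, Real.log (pdf X P volume (X ω)).toReal ∂P :=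
  pdf.integral_pdf_smul
    (measurable_log_toReal (measurable_pdf X P volume)).aestronglyMeasurable

lemma ae_comp_of_hasPDF (h : HasPDF X P volume) {q : E → Prop} (hq : ∀ᵐ x, q x) :
    ∀ᵐ ω ∂P, q (X ω) :=
  ae_of_ae_map h.aemeasurable (h.absolutelyContinuous.ae_le hq)

lemma toReal_pdf_comp_pos [IsProbabilityMeasure P] (h : HasPDF X P volume) :
    ∀ᵐ ω ∂P, 0 < (pdf X P volume (X ω)).toReal := by
  have h1 : ∀ᵐ x ∂(P.map X), pdf X P volume x ≠ 0 := by
    rw [map_eq_withDensity_pdf X P volume,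
      ae_withDensity_iff (measurable_pdf X P volume)]
    exact Filter.Eventually.of_forall fun x hx => hx
  filter_upwards [ae_of_ae_map h.aemeasurable h1,
    ae_comp_of_hasPDF h (Measure.rnDeriv_lt_top (P.map X) volume)] with ω h0 ht
  exact ENNReal.toReal_pos h0 ht.ne

/-- **Gibbs' inequality** with its case of equality. -/
theorem gibbs_inequality [IsProbabilityMeasure P] (h : HasFiniteEntropy X P) {g : E → ℝ≥0∞}
    (hg : Measurable g) {K : ℝ} (hK : 0 < K) (hgK : ∫⁻ x, g x ≤ ENNReal.ofReal K)
    (hi : Integrable (fun ω => Real.log (g (X ω)).toReal) P) (h0 : ∀ᵐ ω ∂P, g (X ω) ≠ 0) :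
    ∫ ω, Real.log (g (X ω)).toReal ∂P ≤ entropyS X P + Real.log K ∧
    (∫ ω, Real.log (g (X ω)).toReal ∂P = entropyS X P + Real.log K →
      g =ᵐ[volume] fun x => ENNReal.ofReal K * pdf X P volume x) := by
  have hpdf := h.hasPDF
  have hgtop : ∀ᵐ x, g x ≠ ∞ := by
    filter_upwards [ae_lt_top hg (hgK.trans_lt ENNReal.ofReal_lt_top).ne] with x hx using hx.ne
  have hK0 : ENNReal.ofReal K ≠ 0 := by simpa using hK
  set f : E → ℝ≥0∞ := pdf X P volume with hf
  have mf : Measurable f := measurable_pdf X P volume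
  have hftop : ∀ᵐ x, f x ≠ ∞ := by
    filter_upwards [Measure.rnDeriv_lt_top (P.map X) volume] with x hx using hx.ne
  -- The normalized likelihood ratio. Its mean under the law of X is at most 1, only an inequality
  -- because g may also charge the set where f vanishes; then log φ ≤ φ - 1 is integrated.
  set φ : E → ℝ≥0∞ := fun x => g x / (ENNReal.ofReal K * f x) with hφ
  have mφ : Measurable φ := hg.div (mf.const_mul _)
  have hφ1 : ∫⁻ ω, φ (X ω) ∂P ≤ 1 := by
    rw [← pdf.lintegral_pdf_mul (X := X) (μ := volume) mφ.aemeasurable]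
    calc ∫⁻ x, f x * φ x ≤ ∫⁻ x, (ENNReal.ofReal K)⁻¹ * g x := by
          refine lintegral_mono_ae ?_
          filter_upwards [hftop] with x hx
          by_cases hfx : f x = 0
          · rw [hfx, zero_mul]; exact zero_le
          · rw [hφ]
            simp only [ENNReal.div_eq_inv_mul]
            rw [ENNReal.mul_inv (Or.inl hK0) (Or.inr hfx), ← mul_assoc, mul_comm _ (f x)⁻¹,
              ← mul_assoc, ENNReal.mul_inv_cancel hfx hx, one_mul]
      _ = (ENNReal.ofReal K)⁻¹ * ∫⁻ x, g x := lintegral_const_mul _ hg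
      _ ≤ (ENNReal.ofReal K)⁻¹ * ENNReal.ofReal K := by gcongr
      _ = 1 := ENNReal.inv_mul_cancel hK0 ENNReal.ofReal_ne_top
  have mφX : AEMeasurable (fun ω => φ (X ω)) P :=
    (mφ.comp_aemeasurable hpdf.aemeasurable)
  have hui : Integrable (fun ω => (φ (X ω)).toReal) P :=
    integrable_toReal_of_lintegral_ne_top mφX (hφ1.trans_lt ENNReal.one_lt_top).ne
  have hu1 : ∫ ω, (φ (X ω)).toReal ∂P ≤ 1 := by
    rw [integral_toReal mφX (ae_lt_top' mφX (hφ1.trans_lt ENNReal.one_lt_top).ne)]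
    exact ENNReal.toReal_le_of_le_ofReal zero_le_one (by simpa using hφ1)
  have hpos : ∀ᵐ ω ∂P, 0 < (g (X ω)).toReal := by
    filter_upwards [h0, ae_comp_of_hasPDF hpdf hgtop] with ω h1 h2
      using ENNReal.toReal_pos h1 h2
  have hlog : ∀ᵐ ω ∂P, 0 < (φ (X ω)).toReal ∧ Real.log (φ (X ω)).toReal
      = Real.log (g (X ω)).toReal - Real.log (f (X ω)).toReal - Real.log K := by
    filter_upwards [hpos, toReal_pdf_comp_pos hpdf] with ω h1 h2
    have e : (φ (X ω)).toReal = (g (X ω)).toReal / (K * (f (X ω)).toReal) := by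
      rw [hφ]; simp only [ENNReal.toReal_div, ENNReal.toReal_mul, ENNReal.toReal_ofReal hK.le]
    rw [e]
    refine ⟨by positivity, ?_⟩
    rw [Real.log_div h1.ne' (by positivity), Real.log_mul hK.ne' h2.ne']
    ring
  have hfi : Integrable (fun ω => Real.log (f (X ω)).toReal) P := h.integrable_log
  have hint : ∫ ω, ((φ (X ω)).toReal - 1 - (Real.log (g (X ω)).toReal
      - Real.log (f (X ω)).toReal - Real.log K)) ∂P
      = ∫ ω, (φ (X ω)).toReal ∂P - 1 - (∫ ω, Real.log (g (X ω)).toReal ∂P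
        - entropyS X P - Real.log K) := by
    have j₁ : Integrable (fun ω => (φ (X ω)).toReal - 1) P := hui.sub (integrable_const _)
    have j₂ : Integrable (fun ω => Real.log (g (X ω)).toReal - Real.log (f (X ω)).toReal) P :=
      hi.sub hfi
    have j₃ : Integrable (fun ω => Real.log (g (X ω)).toReal - Real.log (f (X ω)).toReal
      - Real.log K) P := j₂.sub (integrable_const _)
    rw [integral_sub j₁ j₃, integral_sub hui (integrable_const _),
      integral_sub j₂ (integrable_const _),
      integral_sub hi hfi, entropyS_eq_integral_log hpdf]
    simp [hf]
  have hnn : ∀ᵐ ω ∂P, 0 ≤ (φ (X ω)).toReal - 1 - (Real.log (g (X ω)).toReal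
      - Real.log (f (X ω)).toReal - Real.log K) := by
    filter_upwards [hlog] with ω hω
    rw [← hω.2]
    linarith [Real.log_le_sub_one_of_pos hω.1]
  have hge := integral_nonneg_of_ae hnn
  rw [hint] at hge
  refine ⟨by linarith, fun heq => ?_⟩
  have hzero : ∫ ω, ((φ (X ω)).toReal - 1 - (Real.log (g (X ω)).toReal
      - Real.log (f (X ω)).toReal - Real.log K)) ∂P = 0 := by
    rw [hint]; linarith
  rw [integral_eq_zero_iff_of_nonneg_ae hnn ((hui.sub (integrable_const _)).sub
    ((hi.sub hfi).sub (integrable_const _)))] at hzero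
  have hone : ∀ᵐ ω ∂P, φ (X ω) = 1 := by
    filter_upwards [hzero, hlog] with ω hz hω
    simp only [Pi.zero_apply] at hz
    rw [← hω.2] at hz
    by_contra hne
    have hne' : (φ (X ω)).toReal ≠ 1 := fun h1 => hne ((ENNReal.toReal_eq_one_iff _).1 h1)
    linarith [Real.log_lt_sub_one_of_pos hω.1 hne']
  have hone' : ∀ᵐ x ∂(P.map X), φ x = 1 :=
    (ae_map_iff hpdf.aemeasurable (mφ (measurableSet_singleton 1))).2 hone
  rw [map_eq_withDensity_pdf X P volume, ae_withDensity_iff mf] at hone'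
  -- φ = 1 is known only where f is nonzero. Elsewhere K f = 0 ≤ g, and the bound on the mass of g
  -- excludes any excess.
  refine (ae_eq_of_ae_le_of_lintegral_le (f := fun x => ENNReal.ofReal K * f x) ?_ ?_
    hg.aemeasurable ?_).symm
  · filter_upwards [hone', hftop] with x hx hx2
    by_cases hfx : f x = 0
    · rw [hfx, mul_zero]; exact zero_le
    · have := hx hfx
      rw [hφ] at this
      simp only at this
      rw [ENNReal.div_eq_one_iff (mul_ne_zero hK0 hfx)
        (ENNReal.mul_ne_top ENNReal.ofReal_ne_top hx2)] at this
      exact this.ge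
  · rw [lintegral_const_mul _ mf, pdf.lintegral_eq_measure_univ]; simp
  · rw [lintegral_const_mul _ mf, pdf.lintegral_eq_measure_univ]; simpa using hgK

end Entropy

/-! ### From the trilinear inequality to the entropic one -/

lemma log_toReal_youngForm {a b c : ℝ} {f₁ f₂ f₃ : ℝ → ℝ≥0∞} {z : ℝ × ℝ}
    (h₁ : 0 < (f₁ (z.1 - z.2)).toReal) (h₂ : 0 < (f₂ z.2).toReal) (h₃ : 0 < (f₃ z.1).toReal) :
    Real.log (youngForm a b c f₁ f₂ f₃ z).toReal = (1 - a) * Real.log (f₁ (z.1 - z.2)).toReal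
      + (1 - b) * Real.log (f₂ z.2).toReal + (1 - c) * Real.log (f₃ z.1).toReal := by
  have e₁ := Real.rpow_pos_of_pos h₁ (1 - a)
  have e₂ := Real.rpow_pos_of_pos h₂ (1 - b)
  have e₃ := Real.rpow_pos_of_pos h₃ (1 - c)
  rw [youngForm, ENNReal.toReal_mul, ENNReal.toReal_mul, ← ENNReal.toReal_rpow,
    ← ENNReal.toReal_rpow, ← ENNReal.toReal_rpow, Real.log_mul (by positivity) e₃.ne',
    Real.log_mul e₁.ne' e₂.ne', Real.log_rpow h₁, Real.log_rpow h₂, Real.log_rpow h₃]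

/-- Trilinear form of Young's inequality with constant `K`, for probability densities. -/
def TrilinearYoung (a b c K : ℝ) : Prop :=
  ∀ f₁ f₂ f₃ : ℝ → ℝ≥0∞, Measurable f₁ → Measurable f₂ → Measurable f₃ →
    ∫⁻ t, f₁ t = 1 → ∫⁻ t, f₂ t = 1 → ∫⁻ t, f₃ t = 1 →
      ∫⁻ z, youngForm a b c f₁ f₂ f₃ z ≤ ENNReal.ofReal K

theorem trilinearYoung_youngSharp {a b c : ℝ} (h : YoungWeights a b c) :
    TrilinearYoung a b c (youngSharp a b c) := fun f₁ f₂ f₃ m₁ m₂ m₃ i₁ i₂ i₃ => by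
  rw [← lintegral_youngGauss h]
  exact lintegral_youngForm_le h m₁ m₂ m₃ i₁ i₂ i₃

section Entropic

variable {Ω : Type*} [MeasurableSpace Ω] {P : Measure Ω} {X Y : Ω → ℝ}

/-- The integrand of the trilinear form built from the marginal densities. -/
noncomputable def pdfForm (a b c : ℝ) (P : Measure Ω) (X Y : Ω → ℝ) : ℝ × ℝ → ℝ≥0∞ :=
  youngForm a b c (pdf (fun ω => X ω - Y ω) P volume) (pdf Y P volume) (pdf X P volume)

lemma measurable_pdfForm (a b c : ℝ) : Measurable (pdfForm a b c P X Y) :=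
  measurable_youngForm (measurable_pdf _ _ _) (measurable_pdf _ _ _) (measurable_pdf _ _ _)

variable [IsProbabilityMeasure P]

lemma FiniteEntropies.log_pdfForm (h : FiniteEntropies P X Y) (a b c : ℝ) :
    ∀ᵐ ω ∂P, pdfForm a b c P X Y (X ω, Y ω) ≠ 0 ∧
      Real.log (pdfForm a b c P X Y (X ω, Y ω)).toReal
      = (1 - a) * Real.log (pdf (fun ω => X ω - Y ω) P volume (X ω - Y ω)).toReal
      + (1 - b) * Real.log (pdf Y P volume (Y ω)).toReal
      + (1 - c) * Real.log (pdf X P volume (X ω)).toReal := by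
  filter_upwards [toReal_pdf_comp_pos h.left.hasPDF, toReal_pdf_comp_pos h.right.hasPDF,
    toReal_pdf_comp_pos h.sub.hasPDF] with ω h₃ h₂ h₁
  refine ⟨?_, log_toReal_youngForm h₁ h₂ h₃⟩
  rw [ENNReal.toReal_pos_iff] at h₁ h₂ h₃
  exact mul_ne_zero (mul_ne_zero (ENNReal.rpow_pos h₁.1 h₁.2.ne).ne'
    (ENNReal.rpow_pos h₂.1 h₂.2.ne).ne') (ENNReal.rpow_pos h₃.1 h₃.2.ne).ne'

lemma FiniteEntropies.integral_log_pdfForm (h : FiniteEntropies P X Y) (a b c : ℝ) :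
    Integrable (fun ω => Real.log (pdfForm a b c P X Y (X ω, Y ω)).toReal) P ∧
      ∫ ω, Real.log (pdfForm a b c P X Y (X ω, Y ω)).toReal ∂P
      = (1 - c) * entropyS X P + (1 - a) * entropyS (fun ω => X ω - Y ω) P
        + (1 - b) * entropyS Y P := by
  have e := (h.log_pdfForm a b c).mono fun ω hω => hω.2
  have i₁ := h.sub.integrable_log.const_mul (1 - a)
  have i₂ := h.right.integrable_log.const_mul (1 - b)
  have i₃ := h.left.integrable_log.const_mul (1 - c)
  refine ⟨((i₁.add i₂).add i₃).congr (by filter_upwards [e] with ω hω using hω.symm), ?_⟩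
  have i₁₂ : Integrable (fun ω => (1 - a) *
      Real.log (pdf (fun ω => X ω - Y ω) P volume (X ω - Y ω)).toReal
      + (1 - b) * Real.log (pdf Y P volume (Y ω)).toReal) P := i₁.add i₂
  rw [integral_congr_ae e, integral_add i₁₂ i₃, integral_add i₁ i₂, integral_const_mul,
    integral_const_mul, integral_const_mul, entropyS_eq_integral_log h.left.hasPDF,
    entropyS_eq_integral_log h.right.hasPDF, entropyS_eq_integral_log h.sub.hasPDF]
  ring

lemma lintegral_pdf_eq_one {E : Type*} [MeasureSpace E] {Z : Ω → E} (h : HasPDF Z P volume) :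
    ∫⁻ x, pdf Z P volume x = 1 := by
  rw [pdf.lintegral_eq_measure_univ]; simp

lemma TrilinearYoung.lintegral_pdfForm {a b c K : ℝ} (hT : TrilinearYoung a b c K)
    (h : FiniteEntropies P X Y) : ∫⁻ z, pdfForm a b c P X Y z ≤ ENNReal.ofReal K :=
  hT _ _ _ (measurable_pdf _ _ _) (measurable_pdf _ _ _) (measurable_pdf _ _ _)
    (lintegral_pdf_eq_one h.sub.hasPDF) (lintegral_pdf_eq_one h.right.hasPDF)
    (lintegral_pdf_eq_one h.left.hasPDF)

/-- The trilinear inequality implies the entropic one, and equality in the latter identifies the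
joint density. -/
theorem TrilinearYoung.entropy_le {a b c K : ℝ} (hT : TrilinearYoung a b c K) (hK : 0 < K)
    (h : FiniteEntropies P X Y) :
    (1 - c) * entropyS X P + (1 - a) * entropyS (fun ω => X ω - Y ω) P + (1 - b) * entropyS Y P
      ≤ entropyS (fun ω => (X ω, Y ω)) P + Real.log K ∧
    ((1 - c) * entropyS X P + (1 - a) * entropyS (fun ω => X ω - Y ω) P + (1 - b) * entropyS Y P
      = entropyS (fun ω => (X ω, Y ω)) P + Real.log K →
      pdfForm a b c P X Y =ᵐ[volume]
        fun z => ENNReal.ofReal K * pdf (fun ω => (X ω, Y ω)) P volume z) := by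
  obtain ⟨hi, he⟩ := h.integral_log_pdfForm a b c
  rw [← he]
  exact gibbs_inequality h.joint (measurable_pdfForm a b c) hK (hT.lintegral_pdfForm h) hi
    ((h.log_pdfForm a b c).mono fun ω hω => hω.1)

end Entropic

/-! ### Equality in the entropic inequality -/

section Equality

variable {Ω : Type*} [MeasurableSpace Ω] {P : Measure Ω}

lemma ProbabilityTheory.HasGaussianLaw.hasFiniteEntropy {X : Ω → ℝ} (hX : HasGaussianLaw X P)
    {s : ℝ} (hs : 0 < s) (hv : Var[X; P] = s) :
    HasFiniteEntropy X P ∧ pdf X P volume =ᵐ[volume] gaussianPDF P[X] s.toNNReal := by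
  have := hX.isProbabilityMeasure
  have hs' : s.toNNReal ≠ 0 := by rwa [ne_eq, Real.toNNReal_eq_zero, not_le]
  have hmap := hX.map_eq_gaussianReal
  rw [hv, gaussianReal_of_var_ne_zero _ hs'] at hmap
  have hpdf : HasPDF X P volume := hasPDF_of_map_eq_withDensity hX.aemeasurable _
    (measurable_gaussianPDF _ _).aemeasurable hmap
  have hae := (pdf.eq_of_map_eq_withDensity (X := X) _
    (measurable_gaussianPDF P[X] s.toNNReal).aemeasurable).1 hmap
  refine ⟨hasFiniteEntropy_of_integrable_log hpdf ?_, hae⟩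
  have hint : Integrable (fun ω => -(Real.log (2 * Real.pi) + Real.log s) / 2
      - (X ω - P[X]) ^ 2 / (2 * s)) P :=
    (integrable_const _).sub
      ((hX.memLp_two.sub (memLp_const _)).integrable_sq.div_const (2 * s))
  refine hint.congr ?_
  filter_upwards [ae_comp_of_hasPDF hpdf hae] with ω hω
  rw [hω, toReal_gaussianPDF, log_gaussianPDFReal _ hs]

lemma YoungCovariance.var_sub {X Y : Ω → ℝ} {a b c v : ℝ} [IsFiniteMeasure P]
    (hX : MemLp X 2 P) (hY : MemLp Y 2 P) (h : YoungWeights a b c)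
    (hc : YoungCovariance P X Y b c v) : Var[fun ω => X ω - Y ω; P] = v * (a * (1 - a)) := by
  rw [variance_fun_sub hX hY, hc.left, hc.right, hc.cov,
    show a = 1 - b - c by linarith [h.sum_eq]]
  ring

/-- Gaussian vectors with the extremal covariance have finite entropies and give equality in the
entropic inequality. -/
theorem YoungCovariance.entropy_eq {X Y : Ω → ℝ} {a b c v : ℝ}
    (hG : HasGaussianLaw (fun ω => (X ω, Y ω)) P) (h : YoungWeights a b c) (hv : 0 < v)
    (hc : YoungCovariance P X Y b c v) :
    FiniteEntropies P X Y ∧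
    (1 - c) * entropyS X P + (1 - a) * entropyS (fun ω => X ω - Y ω) P + (1 - b) * entropyS Y P
      = entropyS (fun ω => (X ω, Y ω)) P + Real.log (youngSharp a b c) := by
  have := hG.isProbabilityMeasure
  have ha1 : 0 < 1 - a := by linarith [h.a_lt]
  have hb1 : 0 < 1 - b := by linarith [h.b_lt]
  have hc1 : 0 < 1 - c := by linarith [h.c_lt]
  have va : 0 < v * (a * (1 - a)) := mul_pos hv (mul_pos h.a_pos ha1)
  have vb : 0 < v * (b * (1 - b)) := mul_pos hv (mul_pos h.b_pos hb1)
  have vc : 0 < v * (c * (1 - c)) := mul_pos hv (mul_pos h.c_pos hc1)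
  obtain ⟨fX, pX⟩ := hG.fst.hasFiniteEntropy vc hc.left
  obtain ⟨fY, pY⟩ := hG.snd.hasFiniteEntropy vb hc.right
  obtain ⟨fZ, pZ⟩ := hG.fun_sub.hasFiniteEntropy va
    (hc.var_sub hG.fst.memLp_two hG.snd.memLp_two h)
  rw [integral_sub hG.fst.integrable hG.snd.integrable] at pZ
  have hmap := map_eq_withDensity_youngForm hG h hv hc
  have mF := measurable_youngForm (a := a) (b := b) (c := c)
    (measurable_gaussianPDF (P[X] - P[Y]) (v * (a * (1 - a))).toNNReal)
    (measurable_gaussianPDF P[Y] (v * (b * (1 - b))).toNNReal)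
    (measurable_gaussianPDF P[X] (v * (c * (1 - c))).toNNReal)
  have hpdf : HasPDF (fun ω => (X ω, Y ω)) P volume :=
    hasPDF_of_map_eq_withDensity hG.aemeasurable _ (mF.const_mul _).aemeasurable hmap
  have hae := (pdf.eq_of_map_eq_withDensity (X := fun ω => (X ω, Y ω)) _
    (mF.const_mul _).aemeasurable).1 hmap
  -- The joint density is the product of powers of the marginal densities divided by the sharp
  -- constant; integrating the logarithm gives both finiteness of the joint entropy and equality.
  have hlog : ∀ᵐ ω ∂P, Real.log (pdf (fun ω => (X ω, Y ω)) P volume (X ω, Y ω)).toReal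
      = (1 - a) * Real.log (pdf (fun ω => X ω - Y ω) P volume (X ω - Y ω)).toReal
      + (1 - b) * Real.log (pdf Y P volume (Y ω)).toReal
      + (1 - c) * Real.log (pdf X P volume (X ω)).toReal - Real.log (youngSharp a b c) := by
    filter_upwards [ae_comp_of_hasPDF hpdf hae, ae_comp_of_hasPDF fX.hasPDF pX,
      ae_comp_of_hasPDF fY.hasPDF pY, ae_comp_of_hasPDF fZ.hasPDF pZ] with ω h0 h3 h2 h1
    have q : ∀ (m : ℝ) {s : ℝ}, 0 < s → ∀ x, 0 < (gaussianPDF m s.toNNReal x).toReal := by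
      intro m s hs x
      rw [toReal_gaussianPDF]; exact gaussianPDFReal_toNNReal_pos m hs x
    have hpos : 0 < (youngForm a b c (gaussianPDF (P[X] - P[Y]) (v * (a * (1 - a))).toNNReal)
        (gaussianPDF P[Y] (v * (b * (1 - b))).toNNReal)
        (gaussianPDF P[X] (v * (c * (1 - c))).toNNReal) (X ω, Y ω)).toReal := by
      simp only [youngForm, ENNReal.toReal_mul, ← ENNReal.toReal_rpow]
      have := Real.rpow_pos_of_pos (q (P[X] - P[Y]) va (X ω - Y ω)) (1 - a)
      have := Real.rpow_pos_of_pos (q P[Y] vb (Y ω)) (1 - b)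
      have := Real.rpow_pos_of_pos (q P[X] vc (X ω)) (1 - c)
      positivity
    rw [h0, h1, h2, h3, ENNReal.toReal_mul, ENNReal.toReal_inv,
      ENNReal.toReal_ofReal (youngSharp_pos a b c).le,
      Real.log_mul (inv_pos.2 (youngSharp_pos a b c)).ne' hpos.ne', Real.log_inv,
      log_toReal_youngForm (q _ va _) (q _ vb _) (q _ vc _)]
    ring
  have i₁ := fZ.integrable_log.const_mul (1 - a)
  have i₂ := fY.integrable_log.const_mul (1 - b)
  have i₃ := fX.integrable_log.const_mul (1 - c)
  have hfin : FiniteEntropies P X Y := by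
    refine ⟨fX, fZ, fY, hasFiniteEntropy_of_integrable_log hpdf ?_⟩
    refine (((i₁.add i₂).add i₃).sub (integrable_const (Real.log (youngSharp a b c)))).congr ?_
    filter_upwards [hlog] with ω hω using hω.symm
  refine ⟨hfin, ?_⟩
  obtain ⟨hi, he⟩ := hfin.integral_log_pdfForm a b c
  rw [← he, entropyS_eq_integral_log hpdf, ← sub_eq_iff_eq_add]
  have hconst : ∫ _, Real.log (youngSharp a b c) ∂P = Real.log (youngSharp a b c) := by simp
  rw [← hconst, ← integral_sub hi (integrable_const _)]
  refine integral_congr_ae ?_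
  filter_upwards [hlog, hfin.log_pdfForm a b c] with ω h1 h2
  rw [h1, h2.2]

lemma variance_covariance_map {X Y : Ω → ℝ} (h : AEMeasurable (fun ω => (X ω, Y ω)) P) :
    Var[fun z : ℝ × ℝ => z.1; P.map (fun ω => (X ω, Y ω))] = Var[X; P] ∧
    Var[fun z : ℝ × ℝ => z.2; P.map (fun ω => (X ω, Y ω))] = Var[Y; P] ∧
    cov[fun z : ℝ × ℝ => z.1, fun z : ℝ × ℝ => z.2; P.map (fun ω => (X ω, Y ω))]
      = cov[X, Y; P] := by
  refine ⟨?_, ?_, ?_⟩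
  · rw [variance_map (by fun_prop) h]; rfl
  · rw [variance_map (by fun_prop) h]; rfl
  · rw [covariance_map (by fun_prop) (by fun_prop) h]; rfl

/-- The covariance structure only depends on the joint law. -/
lemma YoungCovariance.of_map_eq {Ω' : Type*} [MeasurableSpace Ω'] {Q : Measure Ω'}
    {X Y : Ω → ℝ} {U V : Ω' → ℝ} {b c v : ℝ} (hXY : AEMeasurable (fun ω => (X ω, Y ω)) P)
    (hUV : AEMeasurable (fun ω => (U ω, V ω)) Q)
    (hm : P.map (fun ω => (X ω, Y ω)) = Q.map (fun ω => (U ω, V ω)))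
    (hc : YoungCovariance Q U V b c v) : YoungCovariance P X Y b c v := by
  obtain ⟨e1, e2, e3⟩ := variance_covariance_map hXY
  obtain ⟨f1, f2, f3⟩ := variance_covariance_map hUV
  exact ⟨by rw [← e1, hm, f1, hc.left], by rw [← e2, hm, f2, hc.right],
    by rw [← e3, hm, f3, hc.cov]⟩

lemma YoungCovariance.affine {X Y : Ω → ℝ} {b c v : ℝ} [IsProbabilityMeasure P]
    (hX : MemLp X 2 P) (hY : MemLp Y 2 P) (hc : YoungCovariance P X Y b c v) (l m n : ℝ) :
    YoungCovariance P (fun ω => l * X ω + m) (fun ω => l * Y ω + n) b c (l ^ 2 * v) := by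
  have iX : Integrable (fun ω => l * X ω) P := (hX.integrable (by norm_num)).const_mul l
  have iY : Integrable (fun ω => l * Y ω) P := (hY.integrable (by norm_num)).const_mul l
  refine ⟨?_, ?_, ?_⟩
  · rw [variance_add_const iX.aestronglyMeasurable, variance_const_mul, hc.left]; ring
  · rw [variance_add_const iY.aestronglyMeasurable, variance_const_mul, hc.right]; ring
  · rw [covariance_add_const_left iX, covariance_add_const_right iY, covariance_const_mul_left,
      covariance_const_mul_right, hc.cov]
    ring

/-- **Equality in the sharp entropic Young inequality.** -/
theorem entropy_eq_iff [IsProbabilityMeasure P] {X Y : Ω → ℝ} {a b c : ℝ}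
    (h : YoungWeights a b c) (hf : FiniteEntropies P X Y) :
    (1 - c) * entropyS X P + (1 - a) * entropyS (fun ω => X ω - Y ω) P + (1 - b) * entropyS Y P
      = entropyS (fun ω => (X ω, Y ω)) P + Real.log (youngSharp a b c) ↔
    HasGaussianLaw (fun ω => (X ω, Y ω)) P ∧ ∃ v, 0 < v ∧ YoungCovariance P X Y b c v := by
  refine ⟨fun heq => ?_, fun ⟨hG, v, hv, hc⟩ => (hc.entropy_eq hG h hv).2⟩
  have hpdf := hf.joint.hasPDF
  have hC := youngSharp_pos a b c
  have hC0 : ENNReal.ofReal (youngSharp a b c) ≠ 0 := by simpa using hC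
  have hae := ((trilinearYoung_youngSharp h).entropy_le hC hf).2 heq
  -- Integrating the equality case of Gibbs shows that the three marginal densities are extremal for
  -- the trilinear inequality.
  have hint : ∫⁻ z, pdfForm a b c P X Y z = ∫⁻ w, youngGauss a b c w := by
    rw [lintegral_congr_ae hae, lintegral_const_mul _ (measurable_pdf _ _ _),
      lintegral_pdf_eq_one hpdf, mul_one, lintegral_youngGauss h]
  obtain ⟨l, ⟨m, n⟩, hl⟩ := exists_map_of_lintegral_youngForm_eq h (measurable_pdf _ _ _)
    (measurable_pdf _ _ _) (measurable_pdf _ _ _) (lintegral_pdf_eq_one hf.sub.hasPDF)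
    (lintegral_pdf_eq_one hf.right.hasPDF) (lintegral_pdf_eq_one hf.left.hasPDF)
    (by rw [lintegral_youngGauss h]; exact ENNReal.ofReal_ne_top) hint
  have hGr := hasGaussianLaw_youngRef a b c
  have hmeas : Measurable fun w : ℝ × ℝ => l • w + (m, n) := by fun_prop
  have hmap : P.map (fun ω => (X ω, Y ω))
      = (youngRef a b c).map fun z => (l * youngRefX b c z + m, l * z.2 + n) := by
    have e1 : volume.withDensity (pdfForm a b c P X Y)
        = ENNReal.ofReal (youngSharp a b c) • P.map (fun ω => (X ω, Y ω)) := by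
      rw [withDensity_congr_ae hae, map_eq_withDensity_pdf (fun ω => (X ω, Y ω)) P volume,
        ← withDensity_smul _ (measurable_pdf _ _ _)]
      rfl
    change volume.withDensity (pdfForm a b c P X Y) = _ at hl
    rw [e1, withDensity_youngGauss h, Measure.map_smul,
      AEMeasurable.map_map_of_aemeasurable hmeas.aemeasurable hGr.aemeasurable] at hl
    have e2 := congrArg (fun μ => (ENNReal.ofReal (youngSharp a b c))⁻¹ • μ) hl
    simp only [smul_smul, ENNReal.inv_mul_cancel hC0 ENNReal.ofReal_ne_top, one_smul] at e2
    rw [e2]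
    congr 1
  have hcov := (youngCovariance_youngRef h).affine hGr.fst.memLp_two hGr.snd.memLp_two l m n
  have hm2 : AEMeasurable (fun z => (l * youngRefX b c z + m, l * z.2 + n)) (youngRef a b c) :=
    ((hGr.fst.aemeasurable.const_mul l).add_const m).prodMk
      ((hGr.snd.aemeasurable.const_mul l).add_const n)
  have hcov' := YoungCovariance.of_map_eq hpdf.aemeasurable hm2 hmap hcov
  refine ⟨⟨?_⟩, l ^ 2 * 1, ?_, hcov'⟩
  · rw [hmap]
    have h1 : HasGaussianLaw (fun z => (l * youngRefX b c z, l * z.2)) (youngRef a b c) := by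
      simpa using hGr.fun_smul l
    have h2 := h1.isGaussian_map
    have h3 : (youngRef a b c).map (fun z => (l * youngRefX b c z + m, l * z.2 + n))
        = ((youngRef a b c).map fun z => (l * youngRefX b c z, l * z.2)).map
          fun w => w + (m, n) := by
      rw [AEMeasurable.map_map_of_aemeasurable (by fun_prop) h1.aemeasurable]
      rfl
    rw [h3]
    infer_instance
  -- Slope zero would make the joint law a point mass, which has no density.
  · by_contra hl0
    have hl0' : l = 0 := by nlinarith [sq_nonneg l]
    have h0 : P.map (fun ω => (X ω, Y ω)) {(m, n)} = 1 := by
      rw [hmap, hl0']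
      simp [Measure.map_const]
    have h1 : P.map (fun ω => (X ω, Y ω)) {(m, n)} = 0 :=
      hpdf.absolutelyContinuous (measure_singleton _)
    rw [h1] at h0
    exact zero_ne_one h0

end Equality

/-! ### From the entropic inequality to the trilinear one -/

section Transfer

variable {Ω Ω' E : Type*} [MeasurableSpace Ω] [MeasurableSpace Ω'] [MeasureSpace E]
  {P : Measure Ω} {Q : Measure Ω'} {X : Ω → E} {U : Ω' → E}

lemma pdf_eq_of_map_eq (h : P.map X = Q.map U) : pdf X P volume = pdf U Q volume := by
  rw [pdf_def, pdf_def, h]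

lemma entropyS_eq_of_map_eq (h : P.map X = Q.map U) : entropyS X P = entropyS U Q := by
  rw [entropyS, entropyS, pdf_eq_of_map_eq h]

lemma HasFiniteEntropy.of_map_eq (hX : HasFiniteEntropy X P) (hU : AEMeasurable U Q)
    (h : P.map X = Q.map U) : HasFiniteEntropy U Q := by
  have hp := hX.hasPDF
  refine ⟨⟨hU, ?_, ?_⟩, ?_⟩
  · rw [← h]; infer_instance
  · rw [← h]; exact hp.absolutelyContinuous
  · rw [← pdf_eq_of_map_eq h]; exact hX.integrable

end Transfer

/-- The weights `1 - 1/p`, `1 - 1/q`, `1/r` attached to the exponents. -/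
lemma youngWeights_of_exponents {p q r : ℝ} (hp : 1 < p) (hq : 1 < q) (hr : 1 < r)
    (hpqr : 1 / p + 1 / q = 1 + 1 / r) : YoungWeights (1 - 1 / p) (1 - 1 / q) (1 / r) := by
  refine ⟨?_, ?_, by positivity, by linarith⟩
  · rw [sub_pos, div_lt_one (by linarith)]; exact hp
  · rw [sub_pos, div_lt_one (by linarith)]; exact hq

lemma one_div_conjExponent {r : ℝ} (hr : 1 < r) : 1 / r.conjExponent = 1 - 1 / r := by
  have : r - 1 ≠ 0 := by linarith
  have : r ≠ 0 := by linarith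
  rw [Real.conjExponent]; field_simp

lemma entropySum_eq {Ω : Type*} [MeasurableSpace Ω] {p q r : ℝ} (hr : 1 < r) (P : Measure Ω)
    (X Y : Ω → ℝ) : entropySum p q r P X Y = (1 - 1 / r) * entropyS X P
      + (1 - (1 - 1 / p)) * entropyS (fun ω => X ω - Y ω) P
      + (1 - (1 - 1 / q)) * entropyS Y P := by
  rw [entropySum, one_div_conjExponent hr]; ring

/-- The entropic inequality holds on probability spaces in the lowest universe. -/
lemma EntropicYoung.apply_type {p q r D : ℝ} (h : EntropicYoung.{u} p q r D) {Ω : Type}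
    [MeasurableSpace Ω] (P : Measure Ω) [IsProbabilityMeasure P] (X Y : Ω → ℝ)
    (hf : FiniteEntropies P X Y) :
    entropySum p q r P X Y ≤ entropyS (fun ω => (X ω, Y ω)) P + D := by
  have hup : Measurable (ULift.up : Ω → ULift.{u} Ω) := measurable_up
  have hdown : Measurable (ULift.down : ULift.{u} Ω → Ω) := measurable_down
  have hd : (P.map (ULift.up : Ω → ULift.{u} Ω)).map ULift.down = P := by
    rw [Measure.map_map hdown hup]; exact Measure.map_id
  have : IsProbabilityMeasure (P.map (ULift.up : Ω → ULift.{u} Ω)) :=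
    Measure.isProbabilityMeasure_map hup.aemeasurable
  have key : ∀ {E : Type} [MeasurableSpace E] {Z : Ω → E}, AEMeasurable Z P →
      AEMeasurable (fun ω : ULift.{u} Ω => Z ω.down) (P.map ULift.up) ∧
      P.map Z = (P.map (ULift.up : Ω → ULift.{u} Ω)).map fun ω => Z ω.down := by
    intro E _ Z hZ
    have hZ' : AEMeasurable Z ((P.map (ULift.up : Ω → ULift.{u} Ω)).map ULift.down) := by
      rwa [hd]
    refine ⟨hZ'.comp_measurable hdown, ?_⟩
    have := AEMeasurable.map_map_of_aemeasurable hZ' hdown.aemeasurable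
    rw [hd] at this
    exact this
  obtain ⟨a1, m1⟩ := key hf.left.hasPDF.aemeasurable
  obtain ⟨a2, m2⟩ := key hf.sub.hasPDF.aemeasurable
  obtain ⟨a3, m3⟩ := key hf.right.hasPDF.aemeasurable
  obtain ⟨a4, m4⟩ := key hf.joint.hasPDF.aemeasurable
  have := h (ULift.{u} Ω) (P.map ULift.up) (fun ω => X ω.down) (fun ω => Y ω.down)
    ⟨hf.left.of_map_eq a1 m1, hf.sub.of_map_eq a2 m2, hf.right.of_map_eq a3 m3,
      hf.joint.of_map_eq a4 m4⟩
  simp only [entropySum] at this ⊢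
  rwa [← entropyS_eq_of_map_eq m1, ← entropyS_eq_of_map_eq m2, ← entropyS_eq_of_map_eq m3,
    ← entropyS_eq_of_map_eq m4] at this

/-- A bounded density with bounded support has finite entropy. -/
lemma hasFiniteEntropy_of_map_le {Ω : Type*} [MeasurableSpace Ω] {P : Measure Ω}
    [IsProbabilityMeasure P] {X : Ω → ℝ} (hX : AEMeasurable X P) {K : ℝ≥0∞} (hK : K ≠ ∞) {R : ℝ}
    (hle : P.map X ≤ K • volume.restrict (Set.Icc (-R) R)) : HasFiniteEntropy X P := by
  have hac : P.map X ≪ volume :=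
    ((Measure.absolutelyContinuous_of_le hle).trans Measure.smul_absolutelyContinuous).trans
      Measure.absolutelyContinuous_restrict
  have hpdf : HasPDF X P volume := (Real.hasPDF_iff_of_aemeasurable hX).2 hac
  refine ⟨hpdf, ?_⟩
  have mpdf := measurable_pdf X P volume
  have hb : ∀ᵐ x, pdf X P volume x ≤ (Set.Icc (-R) R).indicator (fun _ => K) x := by
    refine ae_le_of_forall_setLIntegral_le_of_sigmaFinite mpdf fun s hs _ => ?_
    rw [← map_eq_setLIntegral_pdf X P volume hs]
    refine (hle s).trans (le_of_eq ?_)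
    rw [lintegral_indicator_const measurableSet_Icc, Measure.smul_apply, smul_eq_mul,
      Measure.restrict_apply hs, Measure.restrict_apply measurableSet_Icc, Set.inter_comm]
  -- The function x log x extends continuously to 0, so it is bounded on the range of the density.
  obtain ⟨C, hC⟩ := (isCompact_Icc (a := (0 : ℝ)) (b := K.toReal)).exists_bound_of_continuousOn
    (f := fun x => x * Real.log x) Real.continuous_mul_log.continuousOn
  have hind : (fun x => (pdf X P volume x).toReal * Real.log (pdf X P volume x).toReal)
      =ᵐ[volume] (Set.Icc (-R) R).indicator
        fun x => (pdf X P volume x).toReal * Real.log (pdf X P volume x).toReal := by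
    filter_upwards [hb] with x hx
    by_cases hxI : x ∈ Set.Icc (-R) R
    · rw [Set.indicator_of_mem hxI]
    · rw [Set.indicator_of_notMem hxI] at hx ⊢
      have : pdf X P volume x = 0 := le_antisymm hx zero_le
      simp [this]
  rw [integrable_congr hind, integrable_indicator_iff measurableSet_Icc]
  refine Measure.integrableOn_of_bounded (M := C) (by simp)
    (mpdf.ennreal_toReal.mul (measurable_log_toReal mpdf)).aestronglyMeasurable ?_
  filter_upwards [ae_restrict_of_ae hb, ae_restrict_mem measurableSet_Icc] with x hx hxI
  rw [Set.indicator_of_mem hxI] at hx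
  exact hC _ ⟨ENNReal.toReal_nonneg, ENNReal.toReal_mono hK hx⟩

/-- Densities bounded above and below on a bounded support. -/
structure TruncatedDensity (N : ℝ) (f : ℝ → ℝ≥0∞) : Prop where
  measurable : Measurable f
  lintegral_le : ∫⁻ t, f t ≤ 1
  bound : ∀ t, f t ≠ 0 → ENNReal.ofReal N⁻¹ ≤ f t ∧ f t ≤ ENNReal.ofReal N ∧
    t ∈ Set.Icc (-N) N

lemma TruncatedDensity.le {N : ℝ} {f : ℝ → ℝ≥0∞} (h : TruncatedDensity N f) (t : ℝ) :
    f t ≤ ENNReal.ofReal N := by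
  by_cases h0 : f t = 0
  · rw [h0]; exact zero_le
  · exact (h.bound t h0).2.1

lemma TruncatedDensity.abs_log_le {N : ℝ} (hN : 0 < N) {f : ℝ → ℝ≥0∞}
    (h : TruncatedDensity N f) {t : ℝ} (h0 : f t ≠ 0) : |Real.log (f t).toReal| ≤ Real.log N := by
  obtain ⟨h1, h2, -⟩ := h.bound t h0
  have ht : f t ≠ ∞ := (h2.trans_lt ENNReal.ofReal_lt_top).ne
  have h1' : N⁻¹ ≤ (f t).toReal := (ENNReal.ofReal_le_iff_le_toReal ht).1 h1
  have h2' : (f t).toReal ≤ N := ENNReal.toReal_le_of_le_ofReal hN.le h2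
  have hpos : 0 < (f t).toReal := ENNReal.toReal_pos h0 ht
  rw [abs_le]
  constructor
  · rw [← Real.log_inv]; exact Real.log_le_log (inv_pos.2 hN) h1'
  · exact Real.log_le_log hpos h2'

lemma youngForm_ne_zero {a b c : ℝ} (h : YoungWeights a b c) {f₁ f₂ f₃ : ℝ → ℝ≥0∞} {z : ℝ × ℝ}
    (hz : youngForm a b c f₁ f₂ f₃ z ≠ 0) :
    f₁ (z.1 - z.2) ≠ 0 ∧ f₂ z.2 ≠ 0 ∧ f₃ z.1 ≠ 0 := by
  refine ⟨fun h0 => hz ?_, fun h0 => hz ?_, fun h0 => hz ?_⟩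
  · rw [youngForm, h0, ENNReal.zero_rpow_of_pos (by linarith [h.a_lt])]; simp
  · rw [youngForm, h0, ENNReal.zero_rpow_of_pos (by linarith [h.b_lt])]; simp
  · rw [youngForm, h0, ENNReal.zero_rpow_of_pos (by linarith [h.c_lt])]; simp

lemma youngForm_mono {a b c : ℝ} (h : YoungWeights a b c) {f₁ f₂ f₃ g₁ g₂ g₃ : ℝ → ℝ≥0∞}
    {z : ℝ × ℝ} (h₁ : f₁ (z.1 - z.2) ≤ g₁ (z.1 - z.2)) (h₂ : f₂ z.2 ≤ g₂ z.2)
    (h₃ : f₃ z.1 ≤ g₃ z.1) : youngForm a b c f₁ f₂ f₃ z ≤ youngForm a b c g₁ g₂ g₃ z := by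
  have := h.a_lt; have := h.b_lt; have := h.c_lt
  unfold youngForm
  gcongr

/-- Each fibre over a coordinate or over the difference has length at most 2N. The radius 2N
accommodates x - y and serves all three maps. -/
lemma volume_box_le {N : ℝ} (B : Set ℝ) (hB : MeasurableSet B) :
    (volume : Measure (ℝ × ℝ)) (Prod.fst ⁻¹' B ∩ Set.Icc (-N) N ×ˢ Set.Icc (-N) N)
      ≤ ENNReal.ofReal (2 * N) * volume (B ∩ Set.Icc (-(2 * N)) (2 * N)) ∧
    (volume : Measure (ℝ × ℝ)) (Prod.snd ⁻¹' B ∩ Set.Icc (-N) N ×ˢ Set.Icc (-N) N)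
      ≤ ENNReal.ofReal (2 * N) * volume (B ∩ Set.Icc (-(2 * N)) (2 * N)) ∧
    (volume : Measure (ℝ × ℝ)) ((fun z : ℝ × ℝ => z.1 - z.2) ⁻¹' B ∩
        Set.Icc (-N) N ×ˢ Set.Icc (-N) N)
      ≤ ENNReal.ofReal (2 * N) * volume (B ∩ Set.Icc (-(2 * N)) (2 * N)) := by
  have hI : volume (Set.Icc (-N) N) = ENNReal.ofReal (2 * N) := by
    rw [Real.volume_Icc]; congr 1; ring
  have hprod : ∀ s t : Set ℝ, (volume : Measure (ℝ × ℝ)) (s ×ˢ t) = volume s * volume t :=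
    fun s t => Measure.prod_prod s t
  refine ⟨?_, ?_, ?_⟩
  · rw [← hI, mul_comm, ← hprod]
    refine measure_mono ?_
    rintro ⟨x, y⟩ ⟨hx, ⟨h1, h2⟩, h3⟩
    simp only at h1 h2
    exact ⟨⟨hx, by constructor <;> linarith [h1, h2]⟩, h3⟩
  · rw [← hI, ← hprod]
    refine measure_mono ?_
    rintro ⟨x, y⟩ ⟨hx, h3, ⟨h1, h2⟩⟩
    simp only at h1 h2
    exact ⟨h3, ⟨hx, by constructor <;> linarith [h1, h2]⟩⟩
  · rw [← hI, mul_comm, ← hprod, ← measurePreserving_sub_snd.measure_preimage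
      ((hB.inter measurableSet_Icc).prod measurableSet_Icc).nullMeasurableSet]
    refine measure_mono ?_
    rintro ⟨x, y⟩ ⟨hx, ⟨h1, h2⟩, ⟨h3, h4⟩⟩
    simp only at h1 h2 h3 h4
    exact ⟨⟨hx, by constructor <;> simp only <;> linarith⟩, h3, h4⟩

/-- The entropic Young inequality for probability measures on the plane, in terms of weights. -/
def PlaneEntropicYoung (a b c D : ℝ) : Prop :=
  ∀ (P : Measure (ℝ × ℝ)) [IsProbabilityMeasure P] (X Y : ℝ × ℝ → ℝ), FiniteEntropies P X Y →
    (1 - c) * entropyS X P + (1 - a) * entropyS (fun ω => X ω - Y ω) P + (1 - b) * entropyS Y P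
      ≤ entropyS (fun ω => (X ω, Y ω)) P + D

lemma EntropicYoung.plane {p q r D : ℝ} (hr : 1 < r) (h : EntropicYoung.{u} p q r D) :
    PlaneEntropicYoung (1 - 1 / p) (1 - 1 / q) (1 / r) D := fun P _ X Y hf => by
  rw [← entropySum_eq hr]; exact h.apply_type P X Y hf

/-- Gibbs' inequality with K = 1, as f has mass at most 1. The two-sided bounds on f make log f(Z)
bounded, hence integrable. -/
lemma TruncatedDensity.gibbs {E : Type*} [MeasurableSpace E] {P : Measure E}
    [IsProbabilityMeasure P] {Z : E → ℝ} (hZ : HasFiniteEntropy Z P) {N : ℝ} (hN : 0 < N)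
    {f : ℝ → ℝ≥0∞} (hf : TruncatedDensity N f) (h0 : ∀ᵐ ω ∂P, f (Z ω) ≠ 0) :
    Integrable (fun ω => Real.log (f (Z ω)).toReal) P ∧
      ∫ ω, Real.log (f (Z ω)).toReal ∂P ≤ entropyS Z P := by
  have hi : Integrable (fun ω => Real.log (f (Z ω)).toReal) P := by
    refine Integrable.of_bound ((measurable_log_toReal hf.measurable).comp_aemeasurable
      hZ.hasPDF.aemeasurable).aestronglyMeasurable (Real.log N) ?_
    filter_upwards [h0] with ω hω using hf.abs_log_le hN hω
  refine ⟨hi, ?_⟩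
  have := (gibbs_inequality hZ hf.measurable one_pos (by simpa using hf.lintegral_le) hi h0).1
  simpa using this

/-- A variational argument: test the entropic inequality on the law with density F/Z, where Z = ∫F.
Its joint entropy is the weighted sum of the means of log fᵢ minus log Z, while by Gibbs each mean
is at most the matching marginal entropy. The sums cancel and log Z ≤ D remains. Truncation makes
all entropies finite. -/
theorem PlaneEntropicYoung.lintegral_le_of_truncated {a b c D : ℝ}
    (hE : PlaneEntropicYoung a b c D) (h : YoungWeights a b c) {N : ℝ} (hN : 0 < N)
    {f₁ f₂ f₃ : ℝ → ℝ≥0∞} (h₁ : TruncatedDensity N f₁) (h₂ : TruncatedDensity N f₂)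
    (h₃ : TruncatedDensity N f₃) :
    ∫⁻ z, youngForm a b c f₁ f₂ f₃ z ≤ ENNReal.ofReal (Real.exp D) := by
  set F := youngForm a b c f₁ f₂ f₃ with hF
  have mF : Measurable F := measurable_youngForm h₁.measurable h₂.measurable h₃.measurable
  set box : Set (ℝ × ℝ) := Set.Icc (-N) N ×ˢ Set.Icc (-N) N with hbox
  have mbox : MeasurableSet box := measurableSet_Icc.prod measurableSet_Icc
  set M : ℝ≥0∞ := youngForm a b c (fun _ => ENNReal.ofReal N) (fun _ => ENNReal.ofReal N)
    (fun _ => ENNReal.ofReal N) 0 with hM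
  have hMtop : M ≠ ∞ := by
    have := h.a_lt; have := h.b_lt; have := h.c_lt
    refine ENNReal.mul_ne_top (ENNReal.mul_ne_top ?_ ?_) ?_ <;>
    exact ENNReal.rpow_ne_top_of_nonneg (by linarith) ENNReal.ofReal_ne_top
  have hFM : ∀ z, F z ≤ box.indicator (fun _ => M) z := by
    intro z
    by_cases hz : F z = 0
    · rw [hz]; exact zero_le
    · obtain ⟨-, n₂, n₃⟩ := youngForm_ne_zero h hz
      have hzb : z ∈ box := ⟨(h₃.bound _ n₃).2.2, (h₂.bound _ n₂).2.2⟩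
      rw [Set.indicator_of_mem hzb]
      exact youngForm_mono (g₁ := fun _ => ENNReal.ofReal N) (g₂ := fun _ => ENNReal.ofReal N)
        (g₃ := fun _ => ENNReal.ofReal N) h (h₁.le _) (h₂.le _) (h₃.le _)
  set Z := ∫⁻ z, F z with hZ
  by_cases hZ0 : Z = 0
  · rw [hZ0]; exact zero_le
  have hvbox : (volume : Measure (ℝ × ℝ)) box ≠ ∞ := by
    have : (volume : Measure (ℝ × ℝ)) box = volume (Set.Icc (-N) N) * volume (Set.Icc (-N) N) :=
      Measure.prod_prod _ _
    rw [this, Real.volume_Icc]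
    exact ENNReal.mul_ne_top ENNReal.ofReal_ne_top ENNReal.ofReal_ne_top
  have hZtop : Z ≠ ∞ := by
    refine ((lintegral_mono hFM).trans_lt ?_).ne
    rw [lintegral_indicator_const mbox]
    exact (ENNReal.mul_ne_top hMtop hvbox).lt_top
  set P : Measure (ℝ × ℝ) := volume.withDensity fun z => Z⁻¹ * F z with hP
  have mh : Measurable fun z => Z⁻¹ * F z := mF.const_mul _
  have hprob : IsProbabilityMeasure P := by
    refine isProbabilityMeasure_withDensity_of_lintegral ?_
    rw [lintegral_const_mul _ mF]
    exact ENNReal.inv_mul_cancel hZ0 hZtop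
  have hne : ∀ᵐ z ∂P, F z ≠ 0 := by
    rw [hP, ae_withDensity_iff mh]
    exact Filter.Eventually.of_forall fun z hz h0 => hz (by rw [h0, mul_zero])
  have hne₁ : ∀ᵐ z ∂P, f₁ (z.1 - z.2) ≠ 0 := hne.mono fun z hz => (youngForm_ne_zero h hz).1
  have hne₂ : ∀ᵐ z ∂P, f₂ z.2 ≠ 0 := hne.mono fun z hz => (youngForm_ne_zero h hz).2.1
  have hne₃ : ∀ᵐ z ∂P, f₃ z.1 ≠ 0 := hne.mono fun z hz => (youngForm_ne_zero h hz).2.2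
  have hPle : ∀ s, MeasurableSet s → P s ≤ Z⁻¹ * M * volume (s ∩ box) := by
    intro s hs
    rw [hP, withDensity_apply _ hs, mul_assoc, lintegral_const_mul _ mF]
    gcongr
    refine (lintegral_mono hFM).trans ?_
    rw [lintegral_indicator_const mbox, Measure.restrict_apply mbox, Set.inter_comm]
  -- F/Z is bounded and lives on a box, so each marginal is dominated by a multiple of Lebesgue
  -- measure on [-2N, 2N].
  have hmarg : ∀ {ℓ : ℝ × ℝ → ℝ}, Measurable ℓ → (∀ B, MeasurableSet B →
      (volume : Measure (ℝ × ℝ)) (ℓ ⁻¹' B ∩ box)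
        ≤ ENNReal.ofReal (2 * N) * volume (B ∩ Set.Icc (-(2 * N)) (2 * N))) →
      HasFiniteEntropy ℓ P := by
    intro ℓ mℓ hℓ
    refine hasFiniteEntropy_of_map_le mℓ.aemeasurable
      (K := Z⁻¹ * M * ENNReal.ofReal (2 * N)) (ENNReal.mul_ne_top (ENNReal.mul_ne_top
        (ENNReal.inv_ne_top.2 hZ0) hMtop) ENNReal.ofReal_ne_top) (R := 2 * N) ?_
    refine Measure.le_iff.2 fun B hB => ?_
    rw [Measure.map_apply mℓ hB, Measure.smul_apply, smul_eq_mul, Measure.restrict_apply hB,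
      mul_assoc (Z⁻¹ * M)]
    refine (hPle _ (mℓ hB)).trans ?_
    gcongr
    exact hℓ B hB
  have E₃ : HasFiniteEntropy (fun z : ℝ × ℝ => z.1) P :=
    hmarg measurable_fst fun B hB => (volume_box_le B hB).1
  have E₂ : HasFiniteEntropy (fun z : ℝ × ℝ => z.2) P :=
    hmarg measurable_snd fun B hB => (volume_box_le B hB).2.1
  have E₁ : HasFiniteEntropy (fun z : ℝ × ℝ => z.1 - z.2) P :=
    hmarg (measurable_fst.sub measurable_snd) fun B hB => (volume_box_le B hB).2.2
  obtain ⟨i₁, g₁⟩ := h₁.gibbs E₁ hN hne₁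
  obtain ⟨i₂, g₂⟩ := h₂.gibbs E₂ hN hne₂
  obtain ⟨i₃, g₃⟩ := h₃.gibbs E₃ hN hne₃
  have hmapid : P.map (fun z : ℝ × ℝ => (z.1, z.2)) = volume.withDensity fun z => Z⁻¹ * F z :=
    Measure.map_id
  have hjpdf : HasPDF (fun z : ℝ × ℝ => (z.1, z.2)) P volume :=
    hasPDF_of_map_eq_withDensity measurable_id.aemeasurable _ mh.aemeasurable hmapid
  have hjae := (pdf.eq_of_map_eq_withDensity (X := fun z : ℝ × ℝ => (z.1, z.2)) _
    mh.aemeasurable).1 hmapid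
  have hlog : ∀ᵐ z ∂P, Real.log (pdf (fun z : ℝ × ℝ => (z.1, z.2)) P volume (z.1, z.2)).toReal
      = (1 - a) * Real.log (f₁ (z.1 - z.2)).toReal + (1 - b) * Real.log (f₂ z.2).toReal
      + (1 - c) * Real.log (f₃ z.1).toReal - Real.log Z.toReal := by
    filter_upwards [ae_comp_of_hasPDF hjpdf hjae, hne₁, hne₂, hne₃, hne] with z hz n₁ n₂ n₃ n
    have pos : ∀ {f : ℝ → ℝ≥0∞} {t : ℝ}, TruncatedDensity N f → f t ≠ 0 → 0 < (f t).toReal :=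
      fun hf h0 => ENNReal.toReal_pos h0 ((hf.le _).trans_lt ENNReal.ofReal_lt_top).ne
    have hFpos : 0 < (F z).toReal := by
      refine ENNReal.toReal_pos n ((hFM z).trans_lt ?_).ne
      exact (Set.indicator_le_self box (fun _ => M) z).trans_lt hMtop.lt_top
    have hZpos : 0 < Z.toReal := ENNReal.toReal_pos hZ0 hZtop
    rw [hz, ENNReal.toReal_mul, ENNReal.toReal_inv, Real.log_mul (inv_pos.2 hZpos).ne' hFpos.ne',
      Real.log_inv, hF, log_toReal_youngForm (z := (z.1, z.2)) (pos h₁ n₁) (pos h₂ n₂) (pos h₃ n₃)]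
    ring
  have j₁ := i₁.const_mul (1 - a)
  have j₂ := i₂.const_mul (1 - b)
  have j₃ := i₃.const_mul (1 - c)
  have j₁₂ : Integrable (fun z : ℝ × ℝ => (1 - a) * Real.log (f₁ (z.1 - z.2)).toReal
    + (1 - b) * Real.log (f₂ z.2).toReal) P := j₁.add j₂
  have j₁₂₃ : Integrable (fun z : ℝ × ℝ => (1 - a) * Real.log (f₁ (z.1 - z.2)).toReal
    + (1 - b) * Real.log (f₂ z.2).toReal + (1 - c) * Real.log (f₃ z.1).toReal) P := j₁₂.add j₃
  have E₄ : HasFiniteEntropy (fun z : ℝ × ℝ => (z.1, z.2)) P := by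
    refine hasFiniteEntropy_of_integrable_log hjpdf ?_
    refine (j₁₂₃.sub (integrable_const (Real.log Z.toReal))).congr ?_
    filter_upwards [hlog] with z hz using hz.symm
  have key := hE P (fun z => z.1) (fun z => z.2) ⟨E₃, E₁, E₂, E₄⟩
  rw [entropyS_eq_integral_log hjpdf, integral_congr_ae hlog,
    integral_sub j₁₂₃ (integrable_const _), integral_add j₁₂ j₃, integral_add j₁ j₂,
    integral_const_mul, integral_const_mul, integral_const_mul] at key
  have k₁ := mul_le_mul_of_nonneg_left g₁ (show 0 ≤ 1 - a by linarith [h.a_lt])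
  have k₂ := mul_le_mul_of_nonneg_left g₂ (show 0 ≤ 1 - b by linarith [h.b_lt])
  have k₃ := mul_le_mul_of_nonneg_left g₃ (show 0 ≤ 1 - c by linarith [h.c_lt])
  simp only [integral_const, probReal_univ, smul_eq_mul, one_mul] at key
  have hlogZ : Real.log Z.toReal ≤ D := by linarith
  rw [← ENNReal.ofReal_toReal hZtop]
  refine ENNReal.ofReal_le_ofReal ?_
  rwa [← Real.log_le_iff_le_exp (ENNReal.toReal_pos hZ0 hZtop)]

/-- Truncation of a density, from above, from below and in space. -/
noncomputable def truncDensity (f : ℝ → ℝ≥0∞) (n : ℕ) : ℝ → ℝ≥0∞ :=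
  {t | ENNReal.ofReal (n + 1 : ℝ)⁻¹ ≤ f t ∧ f t ≤ ENNReal.ofReal (n + 1) ∧
    t ∈ Set.Icc (-(n + 1 : ℝ)) (n + 1)}.indicator f

lemma truncDensity_le (f : ℝ → ℝ≥0∞) (n : ℕ) (t : ℝ) : truncDensity f n t ≤ f t :=
  Set.indicator_le_self _ _ _

lemma truncatedDensity_truncDensity {f : ℝ → ℝ≥0∞} (hf : Measurable f) (hi : ∫⁻ t, f t ≤ 1)
    (n : ℕ) : TruncatedDensity (n + 1) (truncDensity f n) := by
  refine ⟨?_, (lintegral_mono (truncDensity_le f n)).trans hi, fun t ht => ?_⟩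
  · refine hf.indicator ?_
    exact (measurableSet_le measurable_const hf).inter
      ((measurableSet_le hf measurable_const).inter measurableSet_Icc)
  · have hmem := Set.mem_of_indicator_ne_zero ht
    rw [truncDensity, Set.indicator_of_mem hmem]
    exact hmem

lemma truncDensity_mono (f : ℝ → ℝ≥0∞) (t : ℝ) : Monotone fun n => truncDensity f n t := by
  intro m n hmn
  have hmn' : (m : ℝ) ≤ n := by exact_mod_cast hmn
  refine Set.indicator_le_indicator_of_subset ?_ (fun _ => zero_le) t
  rintro s ⟨h1, h2, h3, h4⟩
  refine ⟨le_trans (ENNReal.ofReal_le_ofReal ?_) h1, h2.trans (ENNReal.ofReal_le_ofReal ?_),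
    by linarith, by linarith⟩
  · gcongr
  · linarith

lemma eventually_truncDensity_eq {f : ℝ → ℝ≥0∞} {t : ℝ} (ht : f t ≠ ∞) :
    ∀ᶠ n in Filter.atTop, truncDensity f n t = f t := by
  by_cases h0 : f t = 0
  · refine Filter.Eventually.of_forall fun n => ?_
    have := truncDensity_le f n t
    rw [h0] at this ⊢
    exact le_antisymm this zero_le
  have hpos := ENNReal.toReal_pos h0 ht
  have htend : Filter.Tendsto (fun n : ℕ => (n : ℝ) + 1) Filter.atTop Filter.atTop :=
    Filter.tendsto_atTop_add_const_right _ _ tendsto_natCast_atTop_atTop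
  filter_upwards [htend.eventually_ge_atTop (f t).toReal, htend.eventually_ge_atTop
    (f t).toReal⁻¹, htend.eventually_ge_atTop |t|] with n h1 h2 h3
  rw [truncDensity]
  refine Set.indicator_of_mem (Set.mem_ofPred_eq ▸ ⟨?_, ?_, ?_⟩) _
  · exact ENNReal.ofReal_le_of_le_toReal (inv_le_of_inv_le₀ hpos h2)
  · exact (ENNReal.le_ofReal_iff_toReal_le ht (by positivity)).2 h1
  · exact abs_le.1 h3

/-- The entropic inequality implies the trilinear one. -/
theorem PlaneEntropicYoung.trilinearYoung {a b c D : ℝ} (hE : PlaneEntropicYoung a b c D)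
    (h : YoungWeights a b c) : TrilinearYoung a b c (Real.exp D) := by
  intro f₁ f₂ f₃ m₁ m₂ m₃ i₁ i₂ i₃
  have top : ∀ {f : ℝ → ℝ≥0∞}, Measurable f → ∫⁻ t, f t = 1 → ∀ᵐ t, f t ≠ ∞ := by
    intro f mf hf
    filter_upwards [ae_lt_top mf (by rw [hf]; simp)] with t ht using ht.ne
  set F : ℕ → ℝ × ℝ → ℝ≥0∞ := fun n =>
    youngForm a b c (truncDensity f₁ n) (truncDensity f₂ n) (truncDensity f₃ n) with hF
  have T₁ := fun n => truncatedDensity_truncDensity m₁ i₁.le n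
  have T₂ := fun n => truncatedDensity_truncDensity m₂ i₂.le n
  have T₃ := fun n => truncatedDensity_truncDensity m₃ i₃.le n
  -- At almost every point the truncations are exact from some n on, so monotone convergence
  -- applies.
  have hle : ∀ᵐ z, youngForm a b c f₁ f₂ f₃ z ≤ ⨆ n, F n z := by
    filter_upwards [quasiMeasurePreserving_sub'.ae (top m₁ i₁),
      (Measure.quasiMeasurePreserving_snd (μ := (volume : Measure ℝ))
        (ν := (volume : Measure ℝ))).ae (top m₂ i₂),
      (Measure.quasiMeasurePreserving_fst (μ := (volume : Measure ℝ))
        (ν := (volume : Measure ℝ))).ae (top m₃ i₃)] with z t₁ t₂ t₃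
    obtain ⟨n, e₁, e₂, e₃⟩ := ((eventually_truncDensity_eq t₁).and
      ((eventually_truncDensity_eq t₂).and (eventually_truncDensity_eq t₃))).exists
    refine le_iSup_of_le n (le_of_eq ?_)
    simp only [hF, youngForm, e₁, e₂, e₃]
  refine (lintegral_mono_ae hle).trans ?_
  rw [lintegral_iSup (fun n => measurable_youngForm (T₁ n).measurable (T₂ n).measurable
    (T₃ n).measurable) fun m n hmn z => youngForm_mono h (truncDensity_mono _ _ hmn)
      (truncDensity_mono _ _ hmn) (truncDensity_mono _ _ hmn)]
  exact iSup_le fun n => hE.lintegral_le_of_truncated h (by positivity) (T₁ n) (T₂ n) (T₃ n)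

/-! ### The trilinear inequality and the convolution inequality -/

lemma youngForm_mul {a b c : ℝ} (h : YoungWeights a b c) {f₁ f₂ f₃ : ℝ → ℝ≥0∞} (k₁ k₂ k₃ : ℝ≥0∞)
    (z : ℝ × ℝ) : youngForm a b c (fun t => k₁ * f₁ t) (fun t => k₂ * f₂ t) (fun t => k₃ * f₃ t) z
      = k₁ ^ (1 - a) * k₂ ^ (1 - b) * k₃ ^ (1 - c) * youngForm a b c f₁ f₂ f₃ z := by
  have := h.a_lt; have := h.b_lt; have := h.c_lt
  simp only [youngForm]
  rw [ENNReal.mul_rpow_of_nonneg _ _ (by linarith), ENNReal.mul_rpow_of_nonneg _ _ (by linarith),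
    ENNReal.mul_rpow_of_nonneg _ _ (by linarith)]
  ring

lemma youngForm_congr_ae {a b c : ℝ} {f₁ f₂ f₃ g₁ g₂ g₃ : ℝ → ℝ≥0∞} (h₁ : f₁ =ᵐ[volume] g₁)
    (h₂ : f₂ =ᵐ[volume] g₂) (h₃ : f₃ =ᵐ[volume] g₃) :
    youngForm a b c f₁ f₂ f₃ =ᵐ[volume] youngForm a b c g₁ g₂ g₃ := by
  filter_upwards [quasiMeasurePreserving_sub'.ae h₁,
    (Measure.quasiMeasurePreserving_snd (μ := (volume : Measure ℝ))
      (ν := (volume : Measure ℝ))).ae h₂,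
    (Measure.quasiMeasurePreserving_fst (μ := (volume : Measure ℝ))
      (ν := (volume : Measure ℝ))).ae h₃] with z e₁ e₂ e₃
  simp only [youngForm, e₁, e₂, e₃]

/-- The homogeneous form of the trilinear inequality. -/
theorem TrilinearYoung.lintegral_le {a b c K : ℝ} (hT : TrilinearYoung a b c K)
    (h : YoungWeights a b c) {f₁ f₂ f₃ : ℝ → ℝ≥0∞}
    (m₁ : AEMeasurable f₁) (m₂ : AEMeasurable f₂) (m₃ : AEMeasurable f₃)
    (i₁ : ∫⁻ t, f₁ t ≠ ∞) (i₂ : ∫⁻ t, f₂ t ≠ ∞) (i₃ : ∫⁻ t, f₃ t ≠ ∞) :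
    ∫⁻ z, youngForm a b c f₁ f₂ f₃ z ≤ ENNReal.ofReal K *
      ((∫⁻ t, f₁ t) ^ (1 - a) * (∫⁻ t, f₂ t) ^ (1 - b) * (∫⁻ t, f₃ t) ^ (1 - c)) := by
  wlog hm : Measurable f₁ ∧ Measurable f₂ ∧ Measurable f₃ generalizing f₁ f₂ f₃
  · have e₁ := lintegral_congr_ae m₁.ae_eq_mk
    have e₂ := lintegral_congr_ae m₂.ae_eq_mk
    have e₃ := lintegral_congr_ae m₃.ae_eq_mk
    rw [lintegral_congr_ae (youngForm_congr_ae m₁.ae_eq_mk m₂.ae_eq_mk m₃.ae_eq_mk), e₁, e₂, e₃]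
    rw [e₁] at i₁; rw [e₂] at i₂; rw [e₃] at i₃
    exact this m₁.measurable_mk.aemeasurable m₂.measurable_mk.aemeasurable
      m₃.measurable_mk.aemeasurable i₁ i₂ i₃
      ⟨m₁.measurable_mk, m₂.measurable_mk, m₃.measurable_mk⟩
  obtain ⟨m₁, m₂, m₃⟩ := hm
  have zero : ∀ {g₁ g₂ g₃ : ℝ → ℝ≥0∞}, (g₁ =ᵐ[volume] 0 ∨ g₂ =ᵐ[volume] 0 ∨ g₃ =ᵐ[volume] 0) →
      ∫⁻ z, youngForm a b c g₁ g₂ g₃ z = 0 := by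
    intro g₁ g₂ g₃ hg
    have hz : youngForm a b c g₁ g₂ g₃ =ᵐ[volume] 0 := by
      rcases hg with hg | hg | hg
      · refine (youngForm_congr_ae hg (ae_eq_refl _) (ae_eq_refl _)).trans
          (Filter.Eventually.of_forall fun z => ?_)
        by_contra hne; exact (youngForm_ne_zero h hne).1 rfl
      · refine (youngForm_congr_ae (ae_eq_refl _) hg (ae_eq_refl _)).trans
          (Filter.Eventually.of_forall fun z => ?_)
        by_contra hne; exact (youngForm_ne_zero h hne).2.1 rfl
      · refine (youngForm_congr_ae (ae_eq_refl _) (ae_eq_refl _) hg).trans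
          (Filter.Eventually.of_forall fun z => ?_)
        by_contra hne; exact (youngForm_ne_zero h hne).2.2 rfl
    rw [lintegral_congr_ae hz]; simp
  -- A function of zero mass cannot be normalized, but then the form vanishes almost everywhere.
  by_cases z₁ : ∫⁻ t, f₁ t = 0
  · rw [zero (Or.inl ((lintegral_eq_zero_iff m₁).1 z₁))]; exact zero_le
  by_cases z₂ : ∫⁻ t, f₂ t = 0
  · rw [zero (Or.inr (Or.inl ((lintegral_eq_zero_iff m₂).1 z₂)))]; exact zero_le
  by_cases z₃ : ∫⁻ t, f₃ t = 0
  · rw [zero (Or.inr (Or.inr ((lintegral_eq_zero_iff m₃).1 z₃)))]; exact zero_le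
  set I₁ := ∫⁻ t, f₁ t
  set I₂ := ∫⁻ t, f₂ t
  set I₃ := ∫⁻ t, f₃ t
  have norm : ∀ {f : ℝ → ℝ≥0∞}, Measurable f → ∫⁻ t, f t ≠ 0 → ∫⁻ t, f t ≠ ∞ →
      ∫⁻ t, (∫⁻ t, f t)⁻¹ * f t = 1 := fun mf h0 ht => by
    rw [lintegral_const_mul _ mf, ENNReal.inv_mul_cancel h0 ht]
  have key := hT (fun t => I₁⁻¹ * f₁ t) (fun t => I₂⁻¹ * f₂ t) (fun t => I₃⁻¹ * f₃ t)
    (m₁.const_mul _) (m₂.const_mul _) (m₃.const_mul _) (norm m₁ z₁ i₁) (norm m₂ z₂ i₂)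
    (norm m₃ z₃ i₃)
  simp_rw [youngForm_mul h] at key
  rw [lintegral_const_mul _ (measurable_youngForm m₁ m₂ m₃), ENNReal.inv_rpow, ENNReal.inv_rpow,
    ENNReal.inv_rpow] at key
  have pos : ∀ {I : ℝ≥0∞} {s : ℝ}, 0 < s → I ≠ 0 → I ≠ ∞ → I ^ s ≠ 0 ∧ I ^ s ≠ ∞ :=
    fun hs h0 ht => ⟨(ENNReal.rpow_pos (pos_iff_ne_zero.2 h0) ht).ne',
      ENNReal.rpow_ne_top_of_nonneg hs.le ht⟩
  obtain ⟨p₁, q₁⟩ := pos (show 0 < 1 - a by linarith [h.a_lt]) z₁ i₁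
  obtain ⟨p₂, q₂⟩ := pos (show 0 < 1 - b by linarith [h.b_lt]) z₂ i₂
  obtain ⟨p₃, q₃⟩ := pos (show 0 < 1 - c by linarith [h.c_lt]) z₃ i₃
  rw [← ENNReal.mul_inv (Or.inl p₁) (Or.inl q₁), ← ENNReal.mul_inv
    (Or.inl (mul_ne_zero p₁ p₂)) (Or.inl (ENNReal.mul_ne_top q₁ q₂)), mul_comm,
    ← ENNReal.div_eq_inv_mul.trans (mul_comm _ _)] at key
  rwa [ENNReal.div_le_iff (mul_ne_zero (mul_ne_zero p₁ p₂) p₃)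
    (ENNReal.mul_ne_top (ENNReal.mul_ne_top q₁ q₂) q₃)] at key

/-- The convolution of two nonnegative functions. -/
noncomputable def lconvYoung (u w : ℝ → ℝ≥0∞) (x : ℝ) : ℝ≥0∞ := ∫⁻ y, u (x - y) * w y

lemma aemeasurable_lconvYoung_integrand {u w : ℝ → ℝ≥0∞} (hu : AEMeasurable u)
    (hw : AEMeasurable w) :
    AEMeasurable (fun z : ℝ × ℝ => u (z.1 - z.2) * w z.2) (volume.prod volume) := by
  have h1 : AEMeasurable (fun z : ℝ × ℝ => u (z.1 - z.2)) (volume.prod volume) :=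
    hu.comp_quasiMeasurePreserving quasiMeasurePreserving_sub'
  have h2 : AEMeasurable (fun z : ℝ × ℝ => w z.2) (volume.prod volume) :=
    hw.comp_quasiMeasurePreserving Measure.quasiMeasurePreserving_snd
  exact h1.mul h2

lemma aemeasurable_lconvYoung {u w : ℝ → ℝ≥0∞} (hu : AEMeasurable u) (hw : AEMeasurable w) :
    AEMeasurable (lconvYoung u w) :=
  (aemeasurable_lconvYoung_integrand hu hw).lintegral_prod_right'

lemma lintegral_youngForm_eq {a b c : ℝ} {f₁ f₂ f₃ : ℝ → ℝ≥0∞} (m₁ : AEMeasurable f₁)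
    (m₂ : AEMeasurable f₂) (m₃ : AEMeasurable f₃) :
    ∫⁻ z, youngForm a b c f₁ f₂ f₃ z
      = ∫⁻ x, lconvYoung (fun t => f₁ t ^ (1 - a)) (fun t => f₂ t ^ (1 - b)) x
          * f₃ x ^ (1 - c) := by
  have hm := aemeasurable_lconvYoung_integrand (m₁.pow_const (1 - a)) (m₂.pow_const (1 - b))
  have h3 : AEMeasurable (fun z : ℝ × ℝ => f₃ z.1 ^ (1 - c)) (volume.prod volume) :=
    (m₃.pow_const _).comp_quasiMeasurePreserving Measure.quasiMeasurePreserving_fst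
  have e := lintegral_prod (μ := volume) (ν := volume) (youngForm a b c f₁ f₂ f₃) (hm.mul h3)
  refine Eq.trans e (lintegral_congr fun x => ?_)
  have hx : AEMeasurable (fun y => f₁ (x - y) ^ (1 - a) * f₂ y ^ (1 - b)) :=
    ((m₁.pow_const _).comp_quasiMeasurePreserving
      (quasiMeasurePreserving_sub_left volume x)).mul (m₂.pow_const _)
  simp only [youngForm]
  rw [lintegral_mul_const'' _ hx]
  rfl

/-- The `L^r` bound for the convolution of nonnegative functions. -/
theorem TrilinearYoung.lintegral_lconv_rpow_le {a b c K : ℝ} (hT : TrilinearYoung a b c K)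
    (h : YoungWeights a b c) {f₁ f₂ : ℝ → ℝ≥0∞} (m₁ : AEMeasurable f₁) (m₂ : AEMeasurable f₂)
    (i₁ : ∫⁻ t, f₁ t ≠ ∞) (i₂ : ∫⁻ t, f₂ t ≠ ∞) :
    (∫⁻ x, lconvYoung (fun t => f₁ t ^ (1 - a)) (fun t => f₂ t ^ (1 - b)) x ^ (1 / c)) ^ c
      ≤ ENNReal.ofReal K * ((∫⁻ t, f₁ t) ^ (1 - a) * (∫⁻ t, f₂ t) ^ (1 - b)) := by
  have hc := h.c_pos
  have hc1 : 0 < 1 - c := by linarith [h.c_lt]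
  set H := lconvYoung (fun t => f₁ t ^ (1 - a)) (fun t => f₂ t ^ (1 - b)) with hH
  have mH : AEMeasurable H := aemeasurable_lconvYoung (m₁.pow_const _) (m₂.pow_const _)
  set B := ENNReal.ofReal K * ((∫⁻ t, f₁ t) ^ (1 - a) * (∫⁻ t, f₂ t) ^ (1 - b)) with hB
  -- The dual extremal H^r with r = 1/c, truncated in height and in space so that its integral is
  -- finite. Since k ≤ H·k^(1-c), the trilinear bound gives ∫k ≤ B (∫k)^(1-c), and the last factor
  -- can be divided out.
  let k : ℕ → ℝ → ℝ≥0∞ := fun n =>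
    (Set.Icc (-(n : ℝ)) n).indicator fun x => min (H x) n ^ (1 / c)
  have mk : ∀ n, AEMeasurable (k n) := fun n =>
    ((mH.min aemeasurable_const).pow_const _).indicator measurableSet_Icc
  have hk : ∀ n, ∫⁻ x, k n x ≤ B ^ (1 / c) := by
    intro n
    have hfin : ∫⁻ x, k n x ≠ ∞ := by
      refine (lt_of_le_of_lt (b := ∫⁻ x, (Set.Icc (-(n : ℝ)) n).indicator
        (fun _ => (n : ℝ≥0∞) ^ (1 / c)) x) ?_ ?_).ne
      · refine lintegral_mono fun x => Set.indicator_le_indicator ?_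
        gcongr
        exact min_le_right _ _
      · rw [lintegral_indicator_const measurableSet_Icc, Real.volume_Icc]
        exact (ENNReal.mul_ne_top (ENNReal.rpow_ne_top_of_nonneg (by positivity) (by simp))
          ENNReal.ofReal_ne_top).lt_top
    have h1 := hT.lintegral_le h m₁ m₂ (mk n) i₁ i₂ hfin
    rw [lintegral_youngForm_eq m₁ m₂ (mk n), ← mul_assoc, ← hB] at h1
    have h2 : ∫⁻ x, k n x ≤ B * (∫⁻ x, k n x) ^ (1 - c) := by
      refine le_trans (lintegral_mono fun x => ?_) h1
      by_cases hx : x ∈ Set.Icc (-(n : ℝ)) n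
      · simp only [k, Set.indicator_of_mem hx]
        have htop : min (H x) n ≠ ∞ := ((min_le_right _ _).trans_lt (by simp)).ne
        by_cases h0 : min (H x) n = 0
        · rw [h0, ENNReal.zero_rpow_of_pos (by positivity)]; exact zero_le
        · calc min (H x) n ^ (1 / c) = min (H x) n * (min (H x) n ^ (1 / c)) ^ (1 - c) := by
                rw [← ENNReal.rpow_mul]
                nth_rewrite 2 [← ENNReal.rpow_one (min (H x) n)]
                rw [← ENNReal.rpow_add _ _ h0 htop]
                congr 1; field_simp; ring
            _ ≤ H x * (min (H x) n ^ (1 / c)) ^ (1 - c) := by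
                gcongr; exact min_le_left _ _
      · simp [k, Set.indicator_of_notMem hx]
    by_cases h0 : ∫⁻ x, k n x = 0
    · rw [h0]; exact zero_le
    · have h3 : (∫⁻ x, k n x) ^ c ≤ B := by
        have e : ∫⁻ x, k n x = (∫⁻ x, k n x) ^ c * (∫⁻ x, k n x) ^ (1 - c) := by
          rw [← ENNReal.rpow_add _ _ h0 hfin, add_sub_cancel, ENNReal.rpow_one]
        nth_rewrite 1 [e] at h2
        exact (ENNReal.mul_le_mul_iff_left (ENNReal.rpow_pos (pos_iff_ne_zero.2 h0) hfin).ne'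
          (ENNReal.rpow_ne_top_of_nonneg hc1.le hfin)).1 h2
      calc ∫⁻ x, k n x = ((∫⁻ x, k n x) ^ c) ^ (1 / c) := by
            rw [← ENNReal.rpow_mul, mul_one_div_cancel hc.ne', ENNReal.rpow_one]
        _ ≤ B ^ (1 / c) := by gcongr
  have hmono : Monotone k := by
    intro m n hmn x
    have hmn' : (m : ℝ) ≤ n := by exact_mod_cast hmn
    refine (Set.indicator_le_indicator_of_subset (Set.Icc_subset_Icc (by linarith) hmn')
      (fun _ => zero_le) x).trans (Set.indicator_le_indicator ?_)
    gcongr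
  have hsup : ∀ x, H x ^ (1 / c) ≤ ⨆ n, k n x := by
    intro x
    obtain ⟨n₀, hn₀⟩ := exists_nat_ge |x|
    have hlim : Filter.Tendsto (fun n : ℕ => min (H x) (n : ℝ≥0∞) ^ (1 / c)) Filter.atTop
        (nhds (min (H x) ∞ ^ (1 / c))) :=
      ((ENNReal.continuous_rpow_const.tendsto _).comp
        (tendsto_const_nhds.min ENNReal.tendsto_nat_nhds_top))
    rw [min_eq_left le_top] at hlim
    refine le_of_tendsto hlim ?_
    filter_upwards [Filter.eventually_ge_atTop n₀] with n hn
    refine le_iSup_of_le n ?_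
    have hn' : (n₀ : ℝ) ≤ n := by exact_mod_cast hn
    have hx : x ∈ Set.Icc (-(n : ℝ)) n := abs_le.1 (hn₀.trans hn')
    simp only [k, Set.indicator_of_mem hx]
    exact le_rfl
  have hfinal : ∫⁻ x, H x ^ (1 / c) ≤ B ^ (1 / c) := by
    refine (lintegral_mono hsup).trans ?_
    rw [lintegral_iSup' mk (Filter.Eventually.of_forall fun x m n hmn => hmono hmn x)]
    exact iSup_le hk
  calc (∫⁻ x, H x ^ (1 / c)) ^ c ≤ (B ^ (1 / c)) ^ c := by gcongr
    _ = B := by rw [← ENNReal.rpow_mul, one_div_mul_cancel hc.ne', ENNReal.rpow_one]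

lemma one_sub_one_sub_one_div (t : ℝ) : 1 - (1 - 1 / t) = 1 / t := by ring

lemma eLpNorm_ofReal_eq {f : ℝ → ℝ} {p : ℝ} (hp : 1 < p) :
    eLpNorm f (ENNReal.ofReal p) volume = (∫⁻ x, ‖f x‖ₑ ^ p) ^ (1 / p) := by
  rw [eLpNorm_eq_lintegral_rpow_enorm_toReal (by simpa using by linarith) ENNReal.ofReal_ne_top,
    ENNReal.toReal_ofReal (by linarith)]

lemma lintegral_rpow_ne_top_of_memLp {f : ℝ → ℝ} {p : ℝ} (hp : 1 < p)
    (hf : MemLp f (ENNReal.ofReal p) volume) : ∫⁻ x, ‖f x‖ₑ ^ p ≠ ∞ := fun h => by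
  have := hf.eLpNorm_ne_top
  rw [eLpNorm_ofReal_eq hp, h, ENNReal.top_rpow_of_pos (by positivity)] at this
  exact this rfl

/-- The two conventions place x - t in different factors; the reflection t ↦ x - t reconciles them.
-/
lemma lintegral_enorm_convolution_integrand (f g : ℝ → ℝ) (x : ℝ) :
    ∫⁻ t, ‖ContinuousLinearMap.mul ℝ ℝ (f t) (g (x - t))‖ₑ
      = lconvYoung (fun t => ‖f t‖ₑ) (fun t => ‖g t‖ₑ) x := by
  rw [lconvYoung, ← lintegral_sub_left_eq_self _ x]
  refine lintegral_congr fun t => ?_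
  rw [ContinuousLinearMap.mul_apply', enorm_mul, sub_sub_cancel]

lemma rpow_rpow_one_div {s : ℝ≥0∞} {p : ℝ} (hp : 1 < p) : (s ^ p) ^ (1 / p) = s := by
  rw [← ENNReal.rpow_mul, mul_one_div_cancel (by linarith), ENNReal.rpow_one]

lemma rpow_one_div_rpow {s : ℝ≥0∞} {p : ℝ} (hp : 1 < p) : (s ^ (1 / p)) ^ p = s := by
  rw [← ENNReal.rpow_mul, one_div_mul_cancel (by linarith), ENNReal.rpow_one]

/-- Apply the nonnegative L^r bound to |f|^p and |g|^q. It controls the convolution H of |f| and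
|g|, which dominates |f * g|; finiteness of ∫H^r also gives absolute convergence almost everywhere.
-/
theorem TrilinearYoung.convolutionYoung {p q r K : ℝ} (hp : 1 < p) (hq : 1 < q) (hr : 1 < r)
    (h : YoungWeights (1 - 1 / p) (1 - 1 / q) (1 / r))
    (hT : TrilinearYoung (1 - 1 / p) (1 - 1 / q) (1 / r) K) : ConvolutionYoung p q r K := by
  intro f g hf hg
  have mf := hf.aestronglyMeasurable
  have mg := hg.aestronglyMeasurable
  set H := lconvYoung (fun t => ‖f t‖ₑ) (fun t => ‖g t‖ₑ) with hH
  have mH : AEMeasurable H := aemeasurable_lconvYoung mf.enorm mg.enorm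
  have key := hT.lintegral_lconv_rpow_le h (mf.enorm.pow_const p) (mg.enorm.pow_const q)
    (lintegral_rpow_ne_top_of_memLp hp hf) (lintegral_rpow_ne_top_of_memLp hq hg)
  simp only [one_sub_one_sub_one_div, rpow_rpow_one_div hp, rpow_rpow_one_div hq,
    one_div_one_div] at key
  rw [← hH, ← eLpNorm_ofReal_eq hp, ← eLpNorm_ofReal_eq hq, ← mul_assoc] at key
  have hB : ENNReal.ofReal K * eLpNorm f (ENNReal.ofReal p) volume
      * eLpNorm g (ENNReal.ofReal q) volume ≠ ∞ :=
    ENNReal.mul_ne_top (ENNReal.mul_ne_top ENNReal.ofReal_ne_top hf.eLpNorm_ne_top)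
      hg.eLpNorm_ne_top
  have hfin : ∫⁻ x, H x ^ r ≠ ∞ := fun hx => by
    rw [hx, ENNReal.top_rpow_of_pos (by positivity)] at key
    exact hB (top_le_iff.1 key)
  have mI := AEStronglyMeasurable.convolution_integrand (μ := volume) (ν := volume)
    (ContinuousLinearMap.mul ℝ ℝ) mf mg
  have mconv : AEStronglyMeasurable (f ⋆[ContinuousLinearMap.mul ℝ ℝ, volume] g) volume :=
    mI.integral_prod_right'
  have hle : eLpNorm (f ⋆[ContinuousLinearMap.mul ℝ ℝ, volume] g) (ENNReal.ofReal r) volume ≤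
      ENNReal.ofReal K *
        eLpNorm f (ENNReal.ofReal p) volume * eLpNorm g (ENNReal.ofReal q) volume := by
    rw [eLpNorm_ofReal_eq hr]
    refine le_trans ?_ key
    gcongr with x
    rw [convolution_def, hH, ← lintegral_enorm_convolution_integrand]
    exact enorm_integral_le_lintegral_enorm _
  refine ⟨?_, ⟨mconv, hle.trans_lt hB.lt_top⟩, hle⟩
  filter_upwards [ae_lt_top' (mH.pow_const r) hfin] with x hx
  have hx' : H x < ∞ := by
    rcases (le_top (a := H x)).lt_or_eq with h1 | h1
    · exact h1
    · rw [h1, ENNReal.top_rpow_of_pos (by linarith)] at hx; exact absurd hx (lt_irrefl _)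
  refine ⟨?_, ?_⟩
  · have m1 : AEStronglyMeasurable (fun t => g (x - t)) volume :=
      mg.comp_quasiMeasurePreserving (quasiMeasurePreserving_sub_left volume x)
    exact mf.mul m1
  · rw [HasFiniteIntegral, lintegral_enorm_convolution_integrand]
    exact hx'

/-- The roots f₁^(1/p), f₂^(1/q) and f₃^(1/r') have unit norm in L^p, L^q and L^r'. Hölder pairs the
convolution of the first two with the third. -/
theorem ConvolutionYoung.trilinearYoung {p q r K : ℝ} (hp : 1 < p) (hq : 1 < q) (hr : 1 < r)
    (hC : ConvolutionYoung p q r K) : TrilinearYoung (1 - 1 / p) (1 - 1 / q) (1 / r) K := by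
  intro f₁ f₂ f₃ m₁ m₂ m₃ i₁ i₂ i₃
  rw [lintegral_youngForm_eq m₁.aemeasurable m₂.aemeasurable m₃.aemeasurable]
  simp only [one_sub_one_sub_one_div]
  have root : ∀ {k : ℝ → ℝ≥0∞} {s : ℝ}, 1 < s → Measurable k → ∫⁻ t, k t = 1 →
      Measurable (fun t => (k t ^ (1 / s)).toReal) ∧
      (fun t => ‖(k t ^ (1 / s)).toReal‖ₑ) =ᵐ[volume] (fun t => k t ^ (1 / s)) ∧
      eLpNorm (fun t => (k t ^ (1 / s)).toReal) (ENNReal.ofReal s) volume = 1 := by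
    intro k s hs mk hk
    have he : (fun t => ‖(k t ^ (1 / s)).toReal‖ₑ) =ᵐ[volume] (fun t => k t ^ (1 / s)) := by
      filter_upwards [ae_lt_top mk (by rw [hk]; simp)] with t ht
      rw [Real.enorm_eq_ofReal ENNReal.toReal_nonneg, ENNReal.ofReal_toReal
        (ENNReal.rpow_ne_top_of_nonneg (by positivity) ht.ne)]
    refine ⟨(mk.pow_const _).ennreal_toReal, he, ?_⟩
    rw [eLpNorm_ofReal_eq hs]
    have : ∫⁻ t, ‖(k t ^ (1 / s)).toReal‖ₑ ^ s = 1 := by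
      rw [← hk]
      refine lintegral_congr_ae ?_
      filter_upwards [he] with t ht
      rw [ht, rpow_one_div_rpow hs]
    rw [this, ENNReal.one_rpow]
  obtain ⟨mf, ef, nf⟩ := root hp m₁ i₁
  obtain ⟨mg, eg, ng⟩ := root hq m₂ i₂
  set f := fun t => (f₁ t ^ (1 / p)).toReal
  set g := fun t => (f₂ t ^ (1 / q)).toReal
  obtain ⟨hex, -, hle⟩ := hC f g ⟨mf.aestronglyMeasurable, by rw [nf]; simp⟩
    ⟨mg.aestronglyMeasurable, by rw [ng]; simp⟩
  rw [nf, ng, mul_one, mul_one, eLpNorm_ofReal_eq hr] at hle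
  have hconv : ∀ᵐ x, lconvYoung (fun t => f₁ t ^ (1 / p)) (fun t => f₂ t ^ (1 / q)) x
      = ‖(f ⋆[ContinuousLinearMap.mul ℝ ℝ, volume] g) x‖ₑ := by
    filter_upwards [hex] with x hx
    have e1 : lconvYoung (fun t => f₁ t ^ (1 / p)) (fun t => f₂ t ^ (1 / q)) x
        = lconvYoung (fun t => ‖f t‖ₑ) (fun t => ‖g t‖ₑ) x := by
      refine lintegral_congr_ae ?_
      filter_upwards [(quasiMeasurePreserving_sub_left volume x).ae ef, eg] with y h1 h2
      rw [h1, h2]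
    have hpos : ∀ t, 0 ≤ ContinuousLinearMap.mul ℝ ℝ (f t) (g (x - t)) := fun t =>
      mul_nonneg ENNReal.toReal_nonneg ENNReal.toReal_nonneg
    rw [e1, ← lintegral_enorm_convolution_integrand, convolution_def,
      Real.enorm_eq_ofReal (integral_nonneg hpos),
      ofReal_integral_eq_lintegral_ofReal hx (Filter.Eventually.of_forall hpos)]
    exact lintegral_congr fun t => Real.enorm_eq_ofReal (hpos t)
  have hrr : r.HolderConjugate r.conjExponent := Real.HolderConjugate.conjExponent hr
  have mH : AEMeasurable (lconvYoung (fun t => f₁ t ^ (1 / p)) (fun t => f₂ t ^ (1 / q))) :=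
    aemeasurable_lconvYoung (m₁.pow_const _).aemeasurable (m₂.pow_const _).aemeasurable
  have hold := ENNReal.lintegral_mul_le_Lp_mul_Lq volume hrr mH
    (m₃.pow_const (1 - 1 / r)).aemeasurable
  have e3 : ∫⁻ x, (f₃ x ^ (1 - 1 / r)) ^ r.conjExponent = 1 := by
    rw [← i₃]
    refine lintegral_congr fun x => ?_
    rw [← one_div_conjExponent hr, rpow_one_div_rpow hrr.symm.lt]
  rw [e3, ENNReal.one_rpow, mul_one] at hold
  refine hold.trans (le_trans (le_of_eq ?_) hle)
  congr 1
  refine lintegral_congr_ae ?_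
  filter_upwards [hconv] with x hx
  rw [hx]

/-! ### The constants and the extremal covariance -/

lemma youngC_eq_exp {t : ℝ} (ht : 1 < t) : youngC t =
    Real.exp (((1 - 1 / t) * Real.log (1 - 1 / t) - 1 / t * Real.log (1 / t)) / 2) := by
  have h0 : 0 < t := by linarith
  have h1 : 0 < t.conjExponent := div_pos h0 (by linarith)
  have e : t.conjExponent = (1 - 1 / t)⁻¹ := by rw [← one_div_conjExponent ht, one_div, inv_inv]
  have hpos : 0 < t ^ (1 / t) / t.conjExponent ^ (1 / t.conjExponent) := by positivity
  rw [youngC, Real.sqrt_eq_rpow, Real.rpow_def_of_pos hpos,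
    Real.log_div (by positivity) (by positivity), Real.log_rpow h0, Real.log_rpow h1,
    one_div_conjExponent ht, e, Real.log_inv, one_div, Real.log_inv]
  congr 1
  ring

/-- The third weight is 1/r where the others are 1 - 1/p and 1 - 1/q. Exchanging a weight with its
complement flips the sign of its exponent, which is why C_r sits in the denominator. -/
lemma youngC_mul_div {p q r : ℝ} (hp : 1 < p) (hq : 1 < q) (hr : 1 < r) :
    youngC p * youngC q / youngC r = youngSharp (1 - 1 / p) (1 - 1 / q) (1 / r) := by
  rw [youngC_eq_exp hp, youngC_eq_exp hq, youngC_eq_exp hr, ← Real.exp_add, ← Real.exp_sub,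
    youngSharp, one_sub_one_sub_one_div, one_sub_one_sub_one_div]
  congr 1
  ring

lemma cotTheta₃_eq {p q r : ℝ} (hp : 1 < p) (hq : 1 < q) (hr : 1 < r) :
    cotTheta₃ p q r = -√((1 - 1 / q) * (1 / r) / (1 - 1 / p)) := by
  have hp1 : 0 < p - 1 := by linarith
  have hq1 : 0 < q - 1 := by linarith
  have hr1 : 0 < r - 1 := by linarith
  have : 0 < p := by linarith
  have : 0 < q := by linarith
  have : 0 < r := by linarith
  rw [cotTheta₃, neg_div, ← Real.sqrt_div' _ (by simp only [Real.conjExponent]; positivity)]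
  congr 2
  simp only [Real.conjExponent]
  field_simp
  ring

/-- Exchanging p and q swaps the two angles up to the sign of the cotangent. -/
lemma cotTheta₂_eq {p q r : ℝ} (hp : 1 < p) (hq : 1 < q) (hr : 1 < r) :
    cotTheta₂ p q r = √((1 - 1 / p) * (1 / r) / (1 - 1 / q)) := by
  have h := cotTheta₃_eq hq hp hr
  rw [← neg_eq_iff_eq_neg, cotTheta₃] at h
  rw [← h, cotTheta₂]
  ring

/-- The entries involve only the squares bc/a and ac/b of the cotangents and their product -c, so
the roots disappear; a + b + c = 1 then brings out the common factor. -/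
lemma youngA_mul_transpose {p q r : ℝ} (hp : 1 < p) (hq : 1 < q) (hr : 1 < r) {a b c : ℝ}
    (ha : a = 1 - 1 / p) (hb : b = 1 - 1 / q) (hc : c = 1 / r) (h : YoungWeights a b c) :
    youngA p q r * (youngA p q r).transpose
      = ((1 - c) / (a * b)) • !![b * (1 - b), b * c; b * c, c * (1 - c)] := by
  have h₃ := cotTheta₃_eq hp hq hr
  have h₂ := cotTheta₂_eq hp hq hr
  rw [← ha, ← hb, ← hc] at h₃ h₂
  have pa := h.a_pos; have pb := h.b_pos; have pc := h.c_pos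
  have hsum : a = 1 - b - c := by linarith [h.sum_eq]
  have s₃ : cotTheta₃ p q r * cotTheta₃ p q r = b * c / a := by
    rw [h₃, neg_mul_neg, Real.mul_self_sqrt (by positivity)]
  have s₂ : cotTheta₂ p q r * cotTheta₂ p q r = a * c / b := by
    rw [h₂, Real.mul_self_sqrt (by positivity)]
  have s₂₃ : cotTheta₃ p q r * cotTheta₂ p q r = -c := by
    rw [h₃, h₂, neg_mul, ← Real.sqrt_mul (by positivity),
      show b * c / a * (a * c / b) = c * c by field_simp, Real.sqrt_mul_self pc.le]
  have e1 : b * c / a + 1 = (1 - c) / (a * b) * (b * (1 - b)) := by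
    field_simp; rw [hsum]; ring
  have e2 : b * c / a + c = (1 - c) / (a * b) * (b * c) := by
    field_simp; rw [hsum]; ring
  have e3 : b * c / a + 2 * c + a * c / b = (1 - c) / (a * b) * (c * (1 - c)) := by
    field_simp; rw [hsum]; ring
  ext i j
  fin_cases i <;> fin_cases j <;>
    simp only [youngA, Matrix.mul_apply, Fin.sum_univ_two, Matrix.transpose_apply,
      Matrix.smul_apply, smul_eq_mul, Fin.zero_eta, Fin.mk_one, Matrix.of_apply,
      Matrix.cons_val_zero, Matrix.cons_val_one, Matrix.cons_val', Matrix.cons_val_fin_one]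
  · rw [← e1]; linarith
  · rw [← e2]; linarith
  · rw [← e2]; linarith
  · rw [← e3]; linarith

lemma covMatrix_eq_smul_iff {Ω : Type*} [MeasurableSpace Ω] {P : Measure Ω} {X Y : Ω → ℝ}
    (hX : AEMeasurable X P) (hY : AEMeasurable Y P) {b c v : ℝ} :
    covMatrix P Y X = v • !![b * (1 - b), b * c; b * c, c * (1 - c)]
      ↔ YoungCovariance P X Y b c v := by
  rw [covMatrix, covariance_self hX, covariance_self hY, covariance_comm Y X]
  constructor
  · intro h
    have h00 := congrFun (congrFun h 0) 0
    have h01 := congrFun (congrFun h 0) 1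
    have h11 := congrFun (congrFun h 1) 1
    simp at h00 h01 h11
    exact ⟨h11, h00, h01⟩
  · rintro ⟨h1, h2, h3⟩
    rw [h1, h2, h3]
    simp [Matrix.smul_of]

lemma exists_covMatrix_eq_iff {Ω : Type*} [MeasurableSpace Ω] {P : Measure Ω} {X Y : Ω → ℝ}
    (hX : AEMeasurable X P) (hY : AEMeasurable Y P) {p q r : ℝ} (hp : 1 < p) (hq : 1 < q)
    (hr : 1 < r) (h : YoungWeights (1 - 1 / p) (1 - 1 / q) (1 / r)) :
    (∃ c : ℝ, 0 < c ∧ covMatrix P Y X = c • (youngA p q r * (youngA p q r).transpose)) ↔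
      ∃ v, 0 < v ∧ YoungCovariance P X Y (1 - 1 / q) (1 / r) v := by
  have hk : 0 < (1 - 1 / r) / ((1 - 1 / p) * (1 - 1 / q)) :=
    div_pos (by linarith [h.c_lt]) (mul_pos h.a_pos h.b_pos)
  rw [youngA_mul_transpose hp hq hr rfl rfl rfl h]
  simp_rw [smul_smul, covMatrix_eq_smul_iff hX hY]
  refine ⟨fun ⟨c, hc, hv⟩ => ⟨_, mul_pos hc hk, hv⟩, fun ⟨v, hv, hc⟩ => ⟨_, div_pos hv hk, ?_⟩⟩
  rwa [div_mul_cancel₀ _ hk.ne']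

/-! ### Optimality of the constants and the final statement -/

lemma ConvolutionYoung.mono {p q r K L : ℝ} (h : ConvolutionYoung p q r K) (hKL : K ≤ L) :
    ConvolutionYoung p q r L := fun f g hf hg => by
  obtain ⟨h1, h2, h3⟩ := h f g hf hg
  exact ⟨h1, h2, h3.trans (by gcongr)⟩

theorem TrilinearYoung.entropicYoung {p q r D : ℝ} (hr : 1 < r)
    (hT : TrilinearYoung (1 - 1 / p) (1 - 1 / q) (1 / r) (Real.exp D)) :
    EntropicYoung.{u} p q r D := fun Ω _ P _ X Y hf => by
  have := (hT.entropy_le (Real.exp_pos D) hf).1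
  rwa [Real.log_exp, ← entropySum_eq hr] at this

/-- The reference Gaussian vector has finite entropies and attains equality with the sharp constant.
-/
theorem EntropicYoung.log_youngSharp_le {p q r D : ℝ} (hr : 1 < r)
    (h : YoungWeights (1 - 1 / p) (1 - 1 / q) (1 / r)) (hE : EntropicYoung.{u} p q r D) :
    Real.log (youngSharp (1 - 1 / p) (1 - 1 / q) (1 / r)) ≤ D := by
  obtain ⟨hf, he⟩ := (youngCovariance_youngRef h).entropy_eq (hasGaussianLaw_youngRef _ _ _) h
    one_pos
  have := hE.apply_type _ _ _ hf
  rw [entropySum_eq hr, he] at this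
  linarith

theorem mainTheorem2 (p q r : ℝ) (hp : 1 < p) (hq : 1 < q) (hr : 1 < r)
    (hpqr : 1 / p + 1 / q = 1 + 1 / r) :
    -- the entropic inequality, with its best constant
    IsLeast {D : ℝ | EntropicYoung.{u} p q r D}
      (Real.log (youngC p * youngC q / youngC r)) ∧
    -- the cases of equality
    (∀ (Ω : Type u) [MeasurableSpace Ω] (P : Measure Ω) [IsProbabilityMeasure P] (X Y : Ω → ℝ),
      FiniteEntropies P X Y →
        (entropySum p q r P X Y = entropyS (fun ω => (X ω, Y ω)) P
            + Real.log (youngC p * youngC q / youngC r) ↔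
          HasGaussianLaw (fun ω => (X ω, Y ω)) P ∧
            ∃ c : ℝ, 0 < c ∧
              covMatrix P Y X = c • (youngA p q r * (youngA p q r).transpose))) ∧
    -- the convolution inequality, with its best constant
    IsLeast {K : ℝ | ConvolutionYoung p q r K} (youngC p * youngC q / youngC r) ∧
    -- the two inequalities are equivalent, for every constant
    (∀ D : ℝ, EntropicYoung.{u} p q r D ↔ ConvolutionYoung p q r (Real.exp D)) := by
  have h := youngWeights_of_exponents hp hq hr hpqr
  have hequiv : ∀ D : ℝ, EntropicYoung.{u} p q r D ↔ ConvolutionYoung p q r (Real.exp D) :=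
    fun D => ⟨fun hE => ((hE.plane hr).trilinearYoung h).convolutionYoung hp hq hr h,
      fun hC => (hC.trilinearYoung hp hq hr).entropicYoung hr⟩
  have hT := trilinearYoung_youngSharp h
  rw [youngC_mul_div hp hq hr]
  set C := youngSharp (1 - 1 / p) (1 - 1 / q) (1 / r) with hCdef
  have hC : 0 < C := youngSharp_pos _ _ _
  refine ⟨⟨?_, fun D hD => hD.log_youngSharp_le hr h⟩, fun Ω _ P _ X Y hf => ?_,
    ⟨hT.convolutionYoung hp hq hr h, fun K hK => ?_⟩, hequiv⟩
  · refine TrilinearYoung.entropicYoung hr ?_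
    rwa [Real.exp_log hC]
  · rw [exists_covMatrix_eq_iff hf.left.hasPDF.aemeasurable hf.right.hasPDF.aemeasurable
      hp hq hr h, ← entropy_eq_iff h hf, entropySum_eq hr]
  -- A competing K need not be positive, so it is first raised to some L in (0, C); log L would then
  -- be too small an entropic constant.
  · by_contra! hlt
    obtain ⟨L, hKL, hL, hLC⟩ : ∃ L, K ≤ L ∧ 0 < L ∧ L < C :=
      ⟨max K (C / 2), le_max_left _ _, lt_max_of_lt_right (by positivity),
        max_lt hlt (by linarith)⟩
    have hK' : ConvolutionYoung p q r K := hK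
    have hE : EntropicYoung.{u} p q r (Real.log L) :=
      (hequiv _).2 (hK'.mono (hKL.trans_eq (Real.exp_log hL).symm))
    have := hE.log_youngSharp_le hr h
    exact absurd ((Real.log_le_log_iff hC hL).1 this) (not_le.2 hLC)
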